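/- Let $m\ge 1$, $j\in\{1,\dots,m\}$, $\beta_0\in\mathbb R^m$, $c\in\mathbb R$, $0<\tau<\infty$, let $\lambda\ge 0$ be a baseline hazard rate and $\Lambda(t)=\int_0^t\lambda(u)\,du$. For every $n$ let failure times $T_i$, censoring times $C_i$ (in $[0,\infty]$) and covariates $z^{(i)}\in\mathbb R^m$, $i=1,\dots,n$, be random variables on a probability space (depending on $n$). Put $X_i=T_i\wedge C_i$, $\delta_i=\mathbf 1\{T_i\le C_i\}$, $N_i(t)=\mathbf 1\{X_i\le t,\delta_i=1\}$, $Y_i(t)=\mathbf 1\{X_i\ge t\}$ and $$S^{(k)}(t,\beta)=\sum_{i=1}^n (z^{(i)})^{\otimes k}\,Y_i(t)e^{\beta^Tz^{(i)}}\ (k=0,1,2),\qquad E=\frac{S^{(1)}}{S^{(0)}},\qquad \dot\ell(\beta)=\sum_{i=1}^n\int_0^\tau\{z^{(i)}-E(u,\beta)\}\,dN_i(u),$$ where $x^{\otimes 0}=1$, $x^{\otimes 1}=x$, $x^{\otimes 2}=xx^T$. Assume the local alternative $\gamma_j=c/\sqrt n$: on $[0,\tau]$, given $z^{(i)}$, the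 time $T_i$ has hazard rate $\lambda_i(t)=g(z^{(i)},\Lambda(t),\beta_0,c/\sqrt n)\,\lambda(t)$, where $$g(z,L,\beta,\gamma)=\frac{\exp\{\beta^Tz+Le^{\gamma z_j}\}}{1+e^{\gamma z_j}\,[\exp\{Le^{\gamma z_j}\}-1]},$$ and the compensator of $N_i$ on $[0,\tau]$, with respect to the history generated by all $z^{(k)}$, $N_k$, $Y_k$, is $\int_0^tY_i(u)\lambda_i(u)\,du$. Assume moreover: a) for each $n$, the triples $(X_i,\delta_i,z^{(i)})$, $i=1,\dots,n$, are i.i.d.; b) $\sup\{t\ge 0:\sum_{i=1}^nY_i(t)>0\}\to\tau$ in probability; c) $\|z^{(i)}\|\le K$ almost surely, for a constant $K$ that does not depend on $i$ and $n$; d) $\Lambda(\tau)<\infty$; e) with $s^{(k)}=\mathbf E S^{(k)}/n$ and $v=s^{(2)}/s^{(0)}-(s^{(1)}/s^{(0)})^{\otimes 2}$ (these depend on $n$; quotients with zero denominator are $0$), the matrix $\Sigma(\beta_0)=\int_0^\tau v(u,\beta_0)\,s^{(0)}(u,\beta_0)\,d\Lambda(u)$ is positive definite, non-degenerately in $n$: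 there is a positive definite matrix $A$, not depending on $n$, such that $\Sigma(\beta_0)-A$ is positive semidefinite for all large $n$. (If $\Sigma(\beta_0)$ converges as $n\to\infty$, this says that its limit is positive definite.) Then, as $n\to\infty$, the probability that the equation $\dot\ell(\beta)=0$ has a unique solution $\beta\in\mathbb R^m$ tends to $1$. Moreover, if $\hat\beta$ almost surely equals this solution whenever a unique solution exists (and is arbitrary otherwise), then $\hat\beta\to\beta_0$ in probability. -/

import Mathlib

open MeasureTheory ProbabilityTheory Filter Topology
open scoped ENNReal

/-- Right censored failure time regression data for `n` units with `m` covariates: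
failure times `T i`, censoring times `C i` (both in `[0, ∞]`) and covariate vectors `z i`. -/
structure SurvivalSample (m n : ℕ) (Ω : Type*) [MeasurableSpace Ω] where
  T : Fin n → Ω → ℝ≥0∞
  C : Fin n → Ω → ℝ≥0∞
  z : Fin n → Ω → EuclideanSpace ℝ (Fin m)
  measurable_T : ∀ i, Measurable (T i)
  measurable_C : ∀ i, Measurable (C i)
  measurable_z : ∀ i, Measurable (z i)

/-- The baseline cumulative hazard `Λ(t) = ∫₀ᵗ λ(u) du`. -/
noncomputable def cumHazard (lam : ℝ → ℝ) (t : ℝ) : ℝ := ∫ u in (0 : ℝ)..t, lam u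

/-- The factor `g(z, Λ, β, γ_j)` of the alternative model. -/
noncomputable def hazardFactor {m : ℕ} (j : Fin m) (z : EuclideanSpace ℝ (Fin m)) (L : ℝ)
    (β : EuclideanSpace ℝ (Fin m)) (γ : ℝ) : ℝ :=
  Real.exp (inner ℝ β z + L * Real.exp (γ * z j)) /
    (1 + Real.exp (γ * z j) * (Real.exp (L * Real.exp (γ * z j)) - 1))

/-- The conditional hazard rate `λ(t | z) = g(z, Λ(t), β, γ_j) λ(t)`. -/
noncomputable def hazardRate {m : ℕ} (lam : ℝ → ℝ) (j : Fin m)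
    (β : EuclideanSpace ℝ (Fin m)) (γ : ℝ) (t : ℝ) (z : EuclideanSpace ℝ (Fin m)) : ℝ :=
  hazardFactor j z (cumHazard lam t) β γ * lam t

namespace SurvivalSample

variable {m n : ℕ} {Ω : Type*} [mΩ : MeasurableSpace Ω]

/-- The observation time `X_i = T_i ∧ C_i`. -/
noncomputable def X (D : SurvivalSample m n Ω) (i : Fin n) (ω : Ω) : ℝ≥0∞ :=
  min (D.T i ω) (D.C i ω)

/-- The failure indicator `δ_i = 1{T_i ≤ C_i}`. -/
noncomputable def δ (D : SurvivalSample m n Ω) (i : Fin n) : Ω → ℝ :=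
  Set.indicator {ω | D.T i ω ≤ D.C i ω} 1

/-- The observation `(X_i, δ_i, z⁽ⁱ⁾)` of the `i`-th unit. -/
noncomputable def obs (D : SurvivalSample m n Ω) (i : Fin n) (ω : Ω) :
    ℝ≥0∞ × ℝ × EuclideanSpace ℝ (Fin m) :=
  (D.X i ω, D.δ i ω, D.z i ω)

/-- The counting process `N_i(t) = 1{X_i ≤ t, δ_i = 1}`. -/
noncomputable def N (D : SurvivalSample m n Ω) (i : Fin n) (t : ℝ) : Ω → ℝ :=
  Set.indicator {ω | D.X i ω ≤ ENNReal.ofReal t ∧ D.δ i ω = 1} 1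

/-- The at-risk process `Y_i(t) = 1{X_i ≥ t}`. -/
noncomputable def Y (D : SurvivalSample m n Ω) (i : Fin n) (t : ℝ) : Ω → ℝ :=
  Set.indicator {ω | ENNReal.ofReal t ≤ D.X i ω} 1

/-- The random time `sup {t ≥ 0 : Y(t) > 0}`, where `Y = ∑ Y_i`. -/
noncomputable def lastAtRisk (D : SurvivalSample m n Ω) (ω : Ω) : ℝ≥0∞ :=
  sSup {s | ∃ t : ℝ, 0 ≤ t ∧ 0 < ∑ i, D.Y i t ω ∧ s = ENNReal.ofReal t}

theorem measurable_X (D : SurvivalSample m n Ω) (i : Fin n) : Measurable (D.X i) :=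
  (D.measurable_T i).min (D.measurable_C i)

theorem measurable_δ (D : SurvivalSample m n Ω) (i : Fin n) : Measurable (D.δ i) :=
  measurable_one.indicator (measurableSet_le (D.measurable_T i) (D.measurable_C i))

theorem measurable_N (D : SurvivalSample m n Ω) (i : Fin n) (t : ℝ) : Measurable (D.N i t) :=
  measurable_one.indicator
    ((measurableSet_le (D.measurable_X i) measurable_const).inter
      ((D.measurable_δ i) (measurableSet_singleton 1)))

theorem measurable_Y (D : SurvivalSample m n Ω) (i : Fin n) (t : ℝ) : Measurable (D.Y i t) :=
  measurable_one.indicator (measurableSet_le measurable_const (D.measurable_X i))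

/-- The history of the observed data on `[0, τ]`: at time `t` it is generated by all covariates
and by the processes `N_i(s)`, `Y_i(s)` for `s ≤ t`. -/
noncomputable def history (D : SurvivalSample m n Ω) (τ : ℝ) :
    Filtration (Set.Icc (0 : ℝ) τ) mΩ where
  seq t := ⨆ i : Fin n, (MeasurableSpace.comap (D.z i) inferInstance ⊔
    ⨆ s : Set.Icc (0 : ℝ) τ, ⨆ _ : s ≤ t,
      (MeasurableSpace.comap (D.N i s) inferInstance ⊔
        MeasurableSpace.comap (D.Y i s) inferInstance))
  mono' _ _ h := iSup_mono fun _ => sup_le_sup le_rfl <|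
    iSup_mono fun _ => iSup_mono' fun hs => ⟨hs.trans h, le_rfl⟩
  le' _ := iSup_le fun i => sup_le (D.measurable_z i).comap_le <|
    iSup_le fun s => iSup_le fun _ =>
      sup_le (D.measurable_N i s).comap_le (D.measurable_Y i s).comap_le

/-- The observations `(X_i, δ_i, z⁽ⁱ⁾)` are independent and identically distributed. -/
def IsIID (D : SurvivalSample m n Ω) (P : Measure Ω) : Prop :=
  iIndepFun D.obs P ∧ ∀ i k, IdentDistrib (D.obs i) (D.obs k) P P

/-- On `[0, τ]`, given `z⁽ⁱ⁾`, the failure time `T_i` has an absolutely continuous distribution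
with hazard rate `h(· | z⁽ⁱ⁾)`:
`P(T_i > t | z⁽ⁱ⁾) = exp (-∫₀ᵗ h(u | z⁽ⁱ⁾) du)` almost surely. -/
def HasHazard (D : SurvivalSample m n Ω) (P : Measure Ω) (τ : ℝ)
    (h : ℝ → EuclideanSpace ℝ (Fin m) → ℝ) : Prop :=
  ∀ i, ∀ t ∈ Set.Icc (0 : ℝ) τ,
    P[Set.indicator {ω | ENNReal.ofReal t < D.T i ω} (fun _ => (1 : ℝ)) |
        MeasurableSpace.comap (D.z i) inferInstance]
      =ᵐ[P] fun ω => Real.exp (-∫ u in (0 : ℝ)..t, h u (D.z i ω))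

/-- The multiplicative intensities model on `[0, τ]`: the compensator of `N_i` with respect to
the history of the observed data is `∫₀ᵗ Y_i(u) h(u | z⁽ⁱ⁾) du`. -/
def HasIntensity (D : SurvivalSample m n Ω) (P : Measure Ω) (τ : ℝ)
    (h : ℝ → EuclideanSpace ℝ (Fin m) → ℝ) : Prop :=
  ∀ i, Martingale
    (fun (t : Set.Icc (0 : ℝ) τ) ω =>
      D.N i t ω - ∫ u in (0 : ℝ)..t, D.Y i u ω * h u (D.z i ω))
    (D.history τ) P

/-- `S⁽⁰⁾(t, β) = ∑ Y_i(t) exp(βᵀz⁽ⁱ⁾)`. -/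
noncomputable def S0 (D : SurvivalSample m n Ω) (t : ℝ) (β : EuclideanSpace ℝ (Fin m))
    (ω : Ω) : ℝ :=
  ∑ i, D.Y i t ω * Real.exp (inner ℝ β (D.z i ω))

/-- `S⁽¹⁾(t, β) = ∑ z⁽ⁱ⁾ Y_i(t) exp(βᵀz⁽ⁱ⁾)`. -/
noncomputable def S1 (D : SurvivalSample m n Ω) (t : ℝ) (β : EuclideanSpace ℝ (Fin m))
    (ω : Ω) : EuclideanSpace ℝ (Fin m) :=
  ∑ i, (D.Y i t ω * Real.exp (inner ℝ β (D.z i ω))) • D.z i ω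

/-- `S⁽²⁾(t, β) = ∑ z⁽ⁱ⁾(z⁽ⁱ⁾)ᵀ Y_i(t) exp(βᵀz⁽ⁱ⁾)`. -/
noncomputable def S2 (D : SurvivalSample m n Ω) (t : ℝ) (β : EuclideanSpace ℝ (Fin m))
    (ω : Ω) : Matrix (Fin m) (Fin m) ℝ :=
  Matrix.of fun a b =>
    ∑ i, D.z i ω a * D.z i ω b * (D.Y i t ω * Real.exp (inner ℝ β (D.z i ω)))

/-- `E(t, β) = S⁽¹⁾(t, β) / S⁽⁰⁾(t, β)`. -/
noncomputable def E (D : SurvivalSample m n Ω) (t : ℝ) (β : EuclideanSpace ℝ (Fin m))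
    (ω : Ω) : EuclideanSpace ℝ (Fin m) :=
  (D.S0 t β ω)⁻¹ • D.S1 t β ω

/-- The Cox partial likelihood score `ℓ̇(t, β) = ∑ᵢ ∫₀ᵗ {z⁽ⁱ⁾ - E(u, β)} dN_i(u)`.
The path of `N_i` has at most one jump, which is of size one and occurs at `X_i` if `δ_i = 1`;
so the `i`-th integral is `N_i(t) {z⁽ⁱ⁾ - E(X_i, β)}`. -/
noncomputable def score (D : SurvivalSample m n Ω) (t : ℝ) (β : EuclideanSpace ℝ (Fin m))
    (ω : Ω) : EuclideanSpace ℝ (Fin m) :=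
  ∑ i, D.N i t ω • (D.z i ω - D.E (D.X i ω).toReal β ω)

/-- `s⁽⁰⁾(t, β) = E S⁽⁰⁾(t, β) / n`. -/
noncomputable def s0 (D : SurvivalSample m n Ω) (P : Measure Ω) (t : ℝ)
    (β : EuclideanSpace ℝ (Fin m)) : ℝ :=
  (∫ ω, D.S0 t β ω ∂P) / n

/-- `s⁽¹⁾(t, β) = E S⁽¹⁾(t, β) / n`. -/
noncomputable def s1 (D : SurvivalSample m n Ω) (P : Measure Ω) (t : ℝ)
    (β : EuclideanSpace ℝ (Fin m)) : EuclideanSpace ℝ (Fin m) :=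
  (n : ℝ)⁻¹ • ∫ ω, D.S1 t β ω ∂P

/-- `s⁽²⁾(t, β) = E S⁽²⁾(t, β) / n`, entry by entry. -/
noncomputable def s2 (D : SurvivalSample m n Ω) (P : Measure Ω) (t : ℝ)
    (β : EuclideanSpace ℝ (Fin m)) : Matrix (Fin m) (Fin m) ℝ :=
  Matrix.of fun a b => (∫ ω, D.S2 t β ω a b ∂P) / n

/-- `e(t, β) = s⁽¹⁾(t, β) / s⁽⁰⁾(t, β)`. -/
noncomputable def e (D : SurvivalSample m n Ω) (P : Measure Ω) (t : ℝ)
    (β : EuclideanSpace ℝ (Fin m)) : EuclideanSpace ℝ (Fin m) :=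
  (D.s0 P t β)⁻¹ • D.s1 P t β

/-- `v(t, β) = s⁽²⁾(t, β) / s⁽⁰⁾(t, β) - e(t, β) e(t, β)ᵀ`. -/
noncomputable def v (D : SurvivalSample m n Ω) (P : Measure Ω) (t : ℝ)
    (β : EuclideanSpace ℝ (Fin m)) : Matrix (Fin m) (Fin m) ℝ :=
  Matrix.of fun a b => D.s2 P t β a b / D.s0 P t β - D.e P t β a * D.e P t β b

/-- `Σ(β) = ∫₀^τ v(u, β) s⁽⁰⁾(u, β) dΛ(u)`, entry by entry. -/
noncomputable def infoMatrix (D : SurvivalSample m n Ω) (P : Measure Ω) (lam : ℝ → ℝ) (τ : ℝ)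
    (β : EuclideanSpace ℝ (Fin m)) : Matrix (Fin m) (Fin m) ℝ :=
  Matrix.of fun a b => ∫ u in (0 : ℝ)..τ, D.v P u β a b * D.s0 P u β * lam u

end SurvivalSample

/-!
The Cox log partial likelihood is concave. Tilting the weights of the risk sets by a bounded factor
changes their variances only by a bounded factor, so a lower bound `n α` for the observed
information at `β₀` bounds the curvature on all of `ℝᵐ`, and a score of norm `o(n)` at `β₀` forces
exactly one zero of the score, close to `β₀`.

Both inputs follow from one L¹ estimate. By the compensator identity `N_i` may be integrated against
`Y_i q dΛ` in the expectation of any predictable integrand. Replacing the risk set averages by the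
corresponding ratios of expectations turns the score and the observed information into sums of
independent bounded variables, at a cost of order `√n`. The means of these sums are `0` and
`n Σ(β₀)`, up to `n r` where `r` is the relative distance of the hazard from that of the Cox model.
For the alternative `γ = c / √n` one can take `r = exp (|γ| K) - 1`, which tends to zero.
-/

section WeightedCovariance

variable {ι : Type*} [Fintype ι]

/-- The covariance of `f` and `g` under the weights `w`, normalised to total mass one. -/
noncomputable def weightedCov (w f g : ι → ℝ) : ℝ :=
  Finset.univ.centerMass w (f * g) - Finset.univ.centerMass w f * Finset.univ.centerMass w g

theorem centerMass_univ_eq_div (w f : ι → ℝ) :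
    Finset.univ.centerMass w f = (∑ k, w k * f k) / ∑ k, w k := by
  simp only [Finset.centerMass, smul_eq_mul, div_eq_inv_mul]

theorem weightedCov_eq_sum_sum_div (w f g : ι → ℝ) :
    weightedCov w f g =
      (∑ k, ∑ l, w k * w l * ((f k - f l) * (g k - g l))) / (2 * (∑ k, w k) ^ 2) := by
  have hexpand : ∀ k l, w k * w l * ((f k - f l) * (g k - g l)) =
      (w k * (f k * g k)) * w l - (w k * f k) * (w l * g l)
        - (w k * g k) * (w l * f l) + w k * (w l * (f l * g l)) := fun k l => by ring
  simp only [weightedCov, centerMass_univ_eq_div, Pi.mul_apply, hexpand, Finset.sum_add_distrib,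
    Finset.sum_sub_distrib, ← Finset.mul_sum, ← Finset.sum_mul]
  by_cases hw : ∑ k, w k = 0
  · simp [hw]
  · field_simp
    ring

theorem exp_neg_mul_sub_sq_le {b x y : ℝ} (hx : |x| ≤ b) (hy : |y| ≤ b) :
    Real.exp (-b) * ((x - y) * (x - y)) ≤ (x - y) * (Real.exp x - Real.exp y) := by
  wlog hyx : y ≤ x generalizing x y
  · linarith [this hy hx (le_of_not_ge hyx)]
  have hsub : 0 ≤ x - y := sub_nonneg.2 hyx
  have hslope : Real.exp (-b) * (x - y) ≤ Real.exp x - Real.exp y := calc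
    Real.exp (-b) * (x - y) ≤ Real.exp y * (x - y) := by
      gcongr
      exact neg_le_of_abs_le hy
    _ ≤ Real.exp y * (Real.exp (x - y) - 1) :=
      mul_le_mul_of_nonneg_left (by linarith [Real.add_one_le_exp (x - y)]) (Real.exp_pos y).le
    _ = Real.exp x - Real.exp y := by rw [mul_sub, ← Real.exp_add]; ring_nf
  linarith [mul_le_mul_of_nonneg_left hslope hsub]

theorem weightedCov_self_nonneg {w : ι → ℝ} (hw : ∀ k, 0 ≤ w k) (x : ι → ℝ) :
    0 ≤ weightedCov w x x := by
  rw [weightedCov_eq_sum_sum_div]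
  exact div_nonneg (Finset.sum_nonneg fun k _ => Finset.sum_nonneg fun l _ =>
    mul_nonneg (mul_nonneg (hw k) (hw l)) (mul_self_nonneg _)) (by positivity)

theorem exp_neg_mul_weightedCov_self_le {p x : ι → ℝ} {b : ℝ} (hp : ∀ k, 0 ≤ p k)
    (hx : ∀ k, |x k| ≤ b) :
    Real.exp (-b) * weightedCov p x x ≤ weightedCov p x (fun k => Real.exp (x k)) := by
  simp only [weightedCov_eq_sum_sum_div, ← mul_div_assoc, Finset.mul_sum]
  refine div_le_div_of_nonneg_right
    (Finset.sum_le_sum fun k _ => Finset.sum_le_sum fun l _ => ?_) (by positivity)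
  rw [mul_left_comm]
  exact mul_le_mul_of_nonneg_left (exp_neg_mul_sub_sq_le (hx k) (hx l))
    (mul_nonneg (hp k) (hp l))

theorem exp_neg_mul_weightedCov_self_le_of_weights {p w : ι → ℝ} {d : ℝ} (hw : ∀ k, 0 ≤ w k)
    (hP : 0 < ∑ k, p k) (hwp : ∀ k, Real.exp (-d) * w k ≤ p k)
    (hpw : ∀ k, p k ≤ Real.exp d * w k) (x : ι → ℝ) :
    Real.exp (-(4 * d)) * weightedCov w x x ≤ weightedCov p x x := by
  have hp : ∀ k, 0 ≤ p k := fun k => (mul_nonneg (Real.exp_pos _).le (hw k)).trans (hwp k)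
  have hPW : ∑ k, p k ≤ Real.exp d * ∑ k, w k := by
    rw [Finset.mul_sum]; exact Finset.sum_le_sum fun k _ => hpw k
  have hnum : Real.exp (-(2 * d)) * ∑ k, ∑ l, w k * w l * ((x k - x l) * (x k - x l)) ≤
      ∑ k, ∑ l, p k * p l * ((x k - x l) * (x k - x l)) := by
    simp only [Finset.mul_sum]
    refine Finset.sum_le_sum fun k _ => Finset.sum_le_sum fun l _ => ?_
    calc Real.exp (-(2 * d)) * (w k * w l * ((x k - x l) * (x k - x l)))
        = (Real.exp (-d) * w k) * (Real.exp (-d) * w l) * ((x k - x l) * (x k - x l)) := by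
          rw [show -(2 * d) = -d + -d by ring, Real.exp_add]; ring
      _ ≤ p k * p l * ((x k - x l) * (x k - x l)) :=
          mul_le_mul_of_nonneg_right (mul_le_mul (hwp k) (hwp l)
            (mul_nonneg (Real.exp_pos _).le (hw l)) (hp k)) (mul_self_nonneg _)
  have hexp : Real.exp (-(4 * d)) * Real.exp d ^ 2 = Real.exp (-(2 * d)) := by
    rw [← Real.exp_nat_mul, ← Real.exp_add]; congr 1; push_cast; ring
  simp only [weightedCov_eq_sum_sum_div]
  set Sw := ∑ k, ∑ l, w k * w l * ((x k - x l) * (x k - x l))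
  set Sp := ∑ k, ∑ l, p k * p l * ((x k - x l) * (x k - x l))
  have hSp : 0 ≤ Sp := Finset.sum_nonneg fun k _ => Finset.sum_nonneg fun l _ =>
    mul_nonneg (mul_nonneg (hp k) (hp l)) (mul_self_nonneg _)
  calc Real.exp (-(4 * d)) * (Sw / (2 * (∑ k, w k) ^ 2))
      = Real.exp (-(2 * d)) * Sw / (2 * (Real.exp d * ∑ k, w k) ^ 2) := by
        rw [← hexp]
        field_simp
    _ ≤ Sp / (2 * (∑ k, p k) ^ 2) := by gcongr

theorem centerMass_mul_exp_sub_centerMass {p x : ι → ℝ} (hp : ∀ k, 0 ≤ p k)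
    (hP : 0 < ∑ k, p k) :
    Finset.univ.centerMass (fun k => p k * Real.exp (x k)) x - Finset.univ.centerMass p x =
      weightedCov p x (fun k => Real.exp (x k)) /
        Finset.univ.centerMass p (fun k => Real.exp (x k)) := by
  have hmass : 0 < ∑ k, p k * Real.exp (x k) := by
    obtain ⟨k, -, hk⟩ := Finset.exists_lt_of_sum_lt (by simpa using hP : ∑ k : ι, 0 < ∑ k, p k)
    exact Finset.sum_pos' (fun l _ => mul_nonneg (hp l) (Real.exp_pos _).le)
      ⟨k, Finset.mem_univ k, mul_pos hk (Real.exp_pos _)⟩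
  simp only [weightedCov, centerMass_univ_eq_div, Pi.mul_apply, mul_right_comm _ (Real.exp _),
    mul_assoc]
  field_simp

theorem exp_neg_mul_weightedCov_le_centerMass_sub {p w x : ι → ℝ} {b d : ℝ}
    (hw : ∀ k, 0 ≤ w k) (hP : 0 < ∑ k, p k) (hwp : ∀ k, Real.exp (-d) * w k ≤ p k)
    (hpw : ∀ k, p k ≤ Real.exp d * w k) (hx : ∀ k, |x k| ≤ b) :
    Real.exp (-(4 * d + 2 * b)) * weightedCov w x x ≤
      Finset.univ.centerMass (fun k => p k * Real.exp (x k)) x - Finset.univ.centerMass p x := by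
  have hp : ∀ k, 0 ≤ p k := fun k => (mul_nonneg (Real.exp_pos _).le (hw k)).trans (hwp k)
  have hmean_pos : 0 < Finset.univ.centerMass p (fun k => Real.exp (x k)) :=
    (convex_Ioi (0 : ℝ)).centerMass_mem (fun k _ => hp k) hP fun k _ => Real.exp_pos _
  have hmean_le : Finset.univ.centerMass p (fun k => Real.exp (x k)) ≤ Real.exp b :=
    (convex_Iic (Real.exp b)).centerMass_mem (fun k _ => hp k) hP
      fun k _ => Real.exp_le_exp.2 (le_of_abs_le (hx k))
  have hcov := exp_neg_mul_weightedCov_self_le_of_weights hw hP hwp hpw x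
  rw [centerMass_mul_exp_sub_centerMass hp hP, le_div_iff₀ hmean_pos]
  calc Real.exp (-(4 * d + 2 * b)) * weightedCov w x x * _
      ≤ Real.exp (-(4 * d + 2 * b)) * weightedCov w x x * Real.exp b :=
        mul_le_mul_of_nonneg_left hmean_le
          (mul_nonneg (Real.exp_pos _).le (weightedCov_self_nonneg hw x))
    _ = Real.exp (-b) * (Real.exp (-(4 * d)) * weightedCov w x x) := by
        rw [show -(4 * d + 2 * b) = -b + -(4 * d) + -b by ring, Real.exp_add, Real.exp_add,
          Real.exp_neg b]
        field_simp
    _ ≤ Real.exp (-b) * weightedCov p x x := by gcongr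
    _ ≤ _ := exp_neg_mul_weightedCov_self_le hp hx

end WeightedCovariance

section Tilting

variable {ι V : Type*} [NormedAddCommGroup V] [InnerProductSpace ℝ V]

theorem abs_inner_le_norm_mul {z : V} {K : ℝ} (hz : ‖z‖ ≤ K) (v : V) :
    |inner ℝ v z| ≤ ‖v‖ * K :=
  (abs_real_inner_le_norm v z).trans (mul_le_mul_of_nonneg_left hz (norm_nonneg v))

theorem hasFDerivAt_inner_right (x β : V) :
    HasFDerivAt (fun β : V => (inner ℝ β x : ℝ)) (innerSL ℝ x) β :=
  (innerSL ℝ x).hasFDerivAt.congr_of_eventuallyEq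
    (Eventually.of_forall fun β => real_inner_comm x β)

theorem exists_eq_zero_of_hasFDerivAt_of_inner_neg [ProperSpace V] {f : V → ℝ} {g : V → V}
    (hf : ∀ x, HasFDerivAt f (innerSL ℝ (g x)) x) {x₀ : V} {ε : ℝ} (hε : 0 < ε)
    (hg : ∀ h, ‖h‖ = ε → inner ℝ h (g (x₀ + h)) < 0) : ∃ x, ‖x - x₀‖ < ε ∧ g x = 0 := by
  obtain ⟨x, hx, hmax⟩ := (isCompact_closedBall x₀ ε).exists_isMaxOn
    ⟨x₀, Metric.mem_closedBall_self hε.le⟩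
    (fun x _ => (hf x).continuousAt.continuousWithinAt : ContinuousOn f (Metric.closedBall x₀ ε))
  have hlt : ‖x - x₀‖ < ε := by
    refine lt_of_le_of_ne (mem_closedBall_iff_norm.1 hx) fun heq => ?_
    have hinward := hg (x - x₀) heq
    have hseg : segment ℝ x x₀ ⊆ Metric.closedBall x₀ ε :=
      (convex_closedBall x₀ ε).segment_subset hx (Metric.mem_closedBall_self hε.le)
    have hderiv := hmax.localize.hasFDerivWithinAt_nonpos (hf x).hasFDerivWithinAt
      (sub_mem_posTangentConeAt_of_segment_subset hseg)
    rw [innerSL_apply_apply, real_inner_comm, ← neg_sub, inner_neg_left] at hderiv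
    rw [add_sub_cancel] at hinward
    linarith
  have hcrit : innerSL ℝ (g x) = 0 := (hmax.isLocalMax (Filter.mem_of_superset
    (Metric.isOpen_ball.mem_nhds (mem_ball_iff_norm.2 hlt))
    Metric.ball_subset_closedBall)).hasFDerivAt_eq_zero (hf x)
  exact ⟨x, hlt, inner_self_eq_zero.1 (DFunLike.congr_fun hcrit (g x))⟩

/-- The property `p` has exactly one solution, and this solution lies within `ε` of `x`. -/
def ExistsUniqueNear (x : V) (ε : ℝ) (p : V → Prop) : Prop :=
  ∃ y, ‖y - x‖ < ε ∧ p y ∧ ∀ y', p y' → y' = y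

/-- The weights `y k` after exponential tilting by `β` at the points `z k`. For a risk set `y` these
are the weights of the Cox partial likelihood. -/
noncomputable def tiltedWeight (y : ι → ℝ) (z : ι → V) (β : V) (k : ι) : ℝ :=
  y k * Real.exp (inner ℝ β (z k))

theorem tiltedWeight_nonneg {y : ι → ℝ} (hy : ∀ k, 0 ≤ y k) (z : ι → V) (β : V) (k : ι) :
    0 ≤ tiltedWeight y z β k :=
  mul_nonneg (hy k) (Real.exp_pos _).le

theorem tiltedWeight_add (y : ι → ℝ) (z : ι → V) (β h : V) (k : ι) :
    tiltedWeight y z (β + h) k = tiltedWeight y z β k * Real.exp (inner ℝ h (z k)) := by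
  rw [tiltedWeight, tiltedWeight, inner_add_left, Real.exp_add, mul_assoc]

variable [Fintype ι]

/-- The variance of `⟪h, z k⟫` under the exponentially tilted weights. -/
noncomputable def tiltedVariance (y : ι → ℝ) (z : ι → V) (β h : V) : ℝ :=
  weightedCov (tiltedWeight y z β) (fun k => inner ℝ h (z k)) fun k => inner ℝ h (z k)

/-- The Cox partial likelihood score built from event weights `N i` and risk sets `y i`. -/
noncomputable def tiltedScore (N : ι → ℝ) (y : ι → ι → ℝ) (z : ι → V) (β : V) : V :=
  ∑ i, N i • (z i - Finset.univ.centerMass (tiltedWeight (y i) z β) z)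

/-- The logarithm of the Cox partial likelihood; its gradient is `tiltedScore`. -/
noncomputable def logTiltedLikelihood (N : ι → ℝ) (y : ι → ι → ℝ) (z : ι → V) (β : V) : ℝ :=
  ∑ i, N i * (inner ℝ β (z i) - Real.log (∑ k, tiltedWeight (y i) z β k))

theorem inner_centerMass (w : ι → ℝ) (z : ι → V) (h : V) :
    inner ℝ h (Finset.univ.centerMass w z) = Finset.univ.centerMass w fun k => inner ℝ h (z k) := by
  simp only [Finset.centerMass, inner_smul_right, inner_sum, smul_eq_mul]

theorem sum_tiltedWeight_pos {y : ι → ℝ} (hy : ∀ k, 0 ≤ y k) (hpos : ∃ k, 0 < y k) (z : ι → V)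
    (β : V) : 0 < ∑ k, tiltedWeight y z β k :=
  let ⟨k, hk⟩ := hpos
  Finset.sum_pos' (fun l _ => tiltedWeight_nonneg hy z β l)
    ⟨k, Finset.mem_univ k, mul_pos hk (Real.exp_pos _)⟩

theorem tiltedVariance_le_inner_centerMass_sub {y : ι → ℝ} (hy : ∀ k, 0 ≤ y k)
    (hpos : ∃ k, 0 < y k) {z : ι → V} {K : ℝ} (hz : ∀ k, ‖z k‖ ≤ K) (β₀ β h : V) :
    Real.exp (-(4 * (‖β - β₀‖ * K) + 2 * (‖h‖ * K))) * tiltedVariance y z β₀ h ≤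
      inner ℝ h (Finset.univ.centerMass (tiltedWeight y z (β + h)) z -
        Finset.univ.centerMass (tiltedWeight y z β) z) := by
  have htilt : ∀ k, tiltedWeight y z β k =
      Real.exp (inner ℝ (β - β₀) (z k)) * tiltedWeight y z β₀ k := fun k => by
    rw [mul_comm, ← tiltedWeight_add, add_sub_cancel]
  have hw := tiltedWeight_nonneg hy z β₀
  have hd := fun k => abs_le.1 (abs_inner_le_norm_mul (hz k) (β - β₀))
  rw [inner_sub_right, inner_centerMass, inner_centerMass, funext (tiltedWeight_add y z β h)]
  refine exp_neg_mul_weightedCov_le_centerMass_sub hw (sum_tiltedWeight_pos hy hpos z β)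
    (fun k => ?_) (fun k => ?_) fun k => abs_inner_le_norm_mul (hz k) h
  · rw [htilt]
    exact mul_le_mul_of_nonneg_right (Real.exp_le_exp.2 (hd k).1) (hw k)
  · rw [htilt]
    exact mul_le_mul_of_nonneg_right (Real.exp_le_exp.2 (hd k).2) (hw k)

theorem inner_tiltedScore_add_le {N : ι → ℝ} {y : ι → ι → ℝ} (hN : ∀ i, 0 ≤ N i)
    (hy : ∀ i k, 0 ≤ y i k) (hpos : ∀ i, N i ≠ 0 → ∃ k, 0 < y i k) {z : ι → V} {K : ℝ}
    (hz : ∀ k, ‖z k‖ ≤ K) (β₀ β h : V) :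
    inner ℝ h (tiltedScore N y z (β + h)) ≤ inner ℝ h (tiltedScore N y z β) -
      Real.exp (-(4 * (‖β - β₀‖ * K) + 2 * (‖h‖ * K))) *
        ∑ i, N i * tiltedVariance (y i) z β₀ h := by
  simp only [tiltedScore, inner_sum, inner_smul_right, Finset.mul_sum]
  rw [← Finset.sum_sub_distrib]
  refine Finset.sum_le_sum fun i _ => ?_
  by_cases hi : N i = 0
  · simp [hi]
  · have hmean := mul_le_mul_of_nonneg_left
      (tiltedVariance_le_inner_centerMass_sub (hy i) (hpos i hi) hz β₀ β h) (hN i)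
    simp only [inner_sub_right] at hmean ⊢
    linarith

theorem hasFDerivAt_sum_tiltedWeight (y : ι → ℝ) (z : ι → V) (β : V) :
    HasFDerivAt (fun β => ∑ k, tiltedWeight y z β k)
      (innerSL ℝ (∑ k, tiltedWeight y z β k • z k)) β := by
  rw [map_sum]
  refine HasFDerivAt.fun_sum fun k _ => ?_
  refine ((hasFDerivAt_inner_right (z k) β).exp.const_mul (y k)).congr_fderiv ?_
  rw [map_smul, smul_smul, tiltedWeight]

theorem hasFDerivAt_logTiltedLikelihood {N : ι → ℝ} {y : ι → ι → ℝ}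
    (hy : ∀ i k, 0 ≤ y i k) (hpos : ∀ i, N i ≠ 0 → ∃ k, 0 < y i k) (z : ι → V) (β : V) :
    HasFDerivAt (logTiltedLikelihood N y z) (innerSL ℝ (tiltedScore N y z β)) β := by
  rw [tiltedScore, map_sum]
  refine HasFDerivAt.fun_sum fun i _ => ?_
  by_cases hi : N i = 0
  · simpa only [hi, zero_mul, zero_smul, map_zero] using hasFDerivAt_const (0 : ℝ) β
  · have hlog := (hasFDerivAt_sum_tiltedWeight (y i) z β).log
      (sum_tiltedWeight_pos (hy i) (hpos i hi) z β).ne'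
    refine (((hasFDerivAt_inner_right (z i) β).sub hlog).const_mul (N i)).congr_fderiv ?_
    rw [Finset.centerMass, map_smul, map_sub, map_smul]

theorem existsUniqueNear_tiltedScore_eq_zero [ProperSpace V] {N : ι → ℝ} {y : ι → ι → ℝ}
    (hN : ∀ i, 0 ≤ N i) (hy : ∀ i k, 0 ≤ y i k) (hpos : ∀ i, N i ≠ 0 → ∃ k, 0 < y i k)
    {z : ι → V} {K : ℝ} (hz : ∀ k, ‖z k‖ ≤ K) {β₀ : V} {ε a : ℝ} (hε : 0 < ε) (ha : 0 < a)
    (hinfo : ∀ h, a * ‖h‖ ^ 2 ≤ ∑ i, N i * tiltedVariance (y i) z β₀ h)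
    (hscore : ‖tiltedScore N y z β₀‖ < Real.exp (-(2 * (ε * K))) * (a * ε)) :
    ExistsUniqueNear β₀ ε fun β => tiltedScore N y z β = 0 := by
  have hsphere : ∀ h, ‖h‖ = ε → inner ℝ h (tiltedScore N y z (β₀ + h)) < 0 := fun h hh => by
    have hdecr := inner_tiltedScore_add_le hN hy hpos hz β₀ β₀ h
    have hcauchy := (real_inner_le_norm h (tiltedScore N y z β₀)).trans_lt
      (mul_lt_mul_of_pos_left hscore (hε.trans_eq hh.symm))
    have hcurv := mul_le_mul_of_nonneg_left (hinfo h) (Real.exp_pos (-(2 * (ε * K)))).le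
    simp only [sub_self, norm_zero, zero_mul, mul_zero, zero_add, hh] at hdecr hcauchy hcurv
    linarith
  obtain ⟨β, hβ, hzero⟩ := exists_eq_zero_of_hasFDerivAt_of_inner_neg
    (hasFDerivAt_logTiltedLikelihood hy hpos z) hε hsphere
  refine ⟨β, hβ, hzero, fun β' hβ' => ?_⟩
  by_contra hne
  have hdecr := inner_tiltedScore_add_le hN hy hpos hz β₀ β (β' - β)
  have hnorm : 0 < ‖β' - β‖ := norm_pos_iff.2 (sub_ne_zero.2 hne)
  have hcurv := mul_pos (Real.exp_pos (-(4 * (‖β - β₀‖ * K) + 2 * (‖β' - β‖ * K))))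
    ((by positivity : 0 < a * ‖β' - β‖ ^ 2).trans_le (hinfo (β' - β)))
  rw [add_sub_cancel, hβ', hzero, inner_zero_right, zero_sub] at hdecr
  linarith

end Tilting

section Hazard

theorem abs_exp_sub_one_le_exp_abs_sub_one (x : ℝ) : |Real.exp x - 1| ≤ Real.exp |x| - 1 := by
  have hle := Real.exp_le_exp.2 (le_abs_self x)
  have hge := Real.exp_le_exp.2 (neg_abs_le x)
  have hcosh := Real.one_le_cosh |x|
  rw [Real.cosh_eq] at hcosh
  exact abs_le.2 ⟨by linarith, by linarith⟩

theorem abs_hazardFactor_sub_le {m : ℕ} (j : Fin m) (z : EuclideanSpace ℝ (Fin m)) {L : ℝ}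
    (hL : 0 ≤ L) (β : EuclideanSpace ℝ (Fin m)) (γ : ℝ) :
    |hazardFactor j z L β γ - Real.exp (inner ℝ β z)| ≤
      |Real.exp (-(γ * z j)) - 1| * Real.exp (inner ℝ β z) := by
  rw [hazardFactor, Real.exp_add, Real.exp_neg]
  have hθ := Real.exp_pos (γ * z j)
  set θ := Real.exp (γ * z j)
  obtain ⟨x, hx⟩ : ∃ x, Real.exp (L * θ) = 1 + x := ⟨_, (add_sub_cancel _ _).symm⟩
  have hx_nonneg : 0 ≤ x := by linarith [Real.one_le_exp (mul_nonneg hL hθ.le)]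
  have hden : 0 < 1 + θ * x := by positivity
  have hdiff : Real.exp (inner ℝ β z) * (1 + x) / (1 + θ * x) - Real.exp (inner ℝ β z) =
      (1 - θ) * x / (1 + θ * x) * Real.exp (inner ℝ β z) := by
    field_simp
    ring
  have hinv : θ⁻¹ - 1 = (1 - θ) / θ := by field_simp
  rw [hx, add_sub_cancel_left, hdiff, hinv, abs_mul, Real.abs_exp]
  gcongr ?_ * _
  rw [abs_div, abs_div, abs_mul, abs_of_nonneg hx_nonneg, abs_of_pos hden, abs_of_pos hθ,
    div_le_div_iff₀ hden hθ, mul_assoc]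
  gcongr
  linarith

theorem abs_hazardFactor_sub_le_of_norm_le {m : ℕ} (j : Fin m) {z : EuclideanSpace ℝ (Fin m)}
    {K : ℝ} (hz : ‖z‖ ≤ K) {L : ℝ} (hL : 0 ≤ L) (β : EuclideanSpace ℝ (Fin m)) (γ : ℝ) :
    |hazardFactor j z L β γ - Real.exp (inner ℝ β z)| ≤
      (Real.exp (|γ| * K) - 1) * Real.exp (inner ℝ β z) := by
  have hzj : |-(γ * z j)| ≤ |γ| * K := by
    rw [abs_neg, abs_mul]
    exact mul_le_mul_of_nonneg_left ((PiLp.norm_apply_le z j).trans hz) (abs_nonneg γ)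
  calc _ ≤ |Real.exp (-(γ * z j)) - 1| * Real.exp (inner ℝ β z) :=
        abs_hazardFactor_sub_le j z hL β γ
    _ ≤ (Real.exp |-(γ * z j)| - 1) * Real.exp (inner ℝ β z) := by
        gcongr; exact abs_exp_sub_one_le_exp_abs_sub_one _
    _ ≤ _ := by gcongr

theorem measurable_hazardFactor {α : Type*} [MeasurableSpace α] {m : ℕ} (j : Fin m)
    {f : α → EuclideanSpace ℝ (Fin m)} {g : α → ℝ} (hf : Measurable f) (hg : Measurable g)
    (β : EuclideanSpace ℝ (Fin m)) (γ : ℝ) :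
    Measurable fun x => hazardFactor j (f x) (g x) β γ := by
  unfold hazardFactor
  fun_prop

theorem cumHazard_nonneg {lam : ℝ → ℝ} (hlam : ∀ t, 0 ≤ lam t) {t : ℝ} (ht : 0 ≤ t) :
    0 ≤ cumHazard lam t :=
  intervalIntegral.integral_nonneg ht fun u _ => hlam u

theorem continuous_cumHazard_projIcc {lam : ℝ → ℝ} {τ : ℝ} (hτ : 0 ≤ τ)
    (hΛ : IntervalIntegrable lam volume 0 τ) :
    Continuous fun u => cumHazard lam (Set.projIcc 0 τ hτ u) := by
  have hcont : ContinuousOn (cumHazard lam) (Set.Icc 0 τ) := by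
    have := intervalIntegral.continuousOn_primitive_interval' hΛ Set.left_mem_uIcc
    rwa [Set.uIcc_of_le hτ] at this
  exact (continuousOn_iff_continuous_domRestrict.1 hcont).comp continuous_projIcc

/-- The measure `dΛ` on `(0, τ]`. -/
noncomputable def hazardMeasure (lam : ℝ → ℝ) (τ : ℝ) : Measure ℝ :=
  (volume.restrict (Set.Ioc 0 τ)).withDensity fun u => ENNReal.ofReal (lam u)

variable {lam : ℝ → ℝ} {τ : ℝ}

theorem isFiniteMeasure_hazardMeasure (hτ : 0 ≤ τ) (hΛ : IntervalIntegrable lam volume 0 τ) :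
    IsFiniteMeasure (hazardMeasure lam τ) :=
  isFiniteMeasure_withDensity_ofReal ((intervalIntegrable_iff_integrableOn_Ioc_of_le hτ).1 hΛ).2

theorem ae_hazardMeasure_mem_Ioc : ∀ᵐ u ∂hazardMeasure lam τ, u ∈ Set.Ioc 0 τ :=
  (withDensity_absolutelyContinuous _ _).ae_le (ae_restrict_mem measurableSet_Ioc)

theorem intervalIntegral_mul_eq_setIntegral_hazardMeasure (hlam : ∀ t, 0 ≤ lam t)
    (hΛ : IntervalIntegrable lam volume 0 τ) {a b : ℝ} (ha : 0 ≤ a) (hab : a ≤ b) (hb : b ≤ τ)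
    (f : ℝ → ℝ) : ∫ u in a..b, f u * lam u = ∫ u in Set.Ioc a b, f u ∂hazardMeasure lam τ := by
  have hsub : Set.Ioc a b ⊆ Set.Ioc 0 τ := Set.Ioc_subset_Ioc ha hb
  have hint := (intervalIntegrable_iff_integrableOn_Ioc_of_le (ha.trans (hab.trans hb))).1 hΛ
  rw [intervalIntegral.integral_of_le hab, hazardMeasure, restrict_withDensity measurableSet_Ioc,
    Measure.restrict_restrict measurableSet_Ioc, Set.inter_eq_left.2 hsub,
    integral_withDensity_eq_integral_toReal_smul₀
      (hint.mono_set hsub).aemeasurable.ennreal_ofReal (by simp)]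
  simp only [ENNReal.toReal_ofReal (hlam _), smul_eq_mul, mul_comm]

end Hazard

section Predictable

variable {Ω : Type*} [mΩ : MeasurableSpace Ω]

/-- The rectangles `A × (a, ∞)` with `A` an event of the history at time `a`. -/
def predictableRectangles (ℱ : Filtration ℝ mΩ) : Set (Set (Ω × ℝ)) :=
  {s | ∃ (a : ℝ) (A : Set Ω), MeasurableSet[ℱ a] A ∧ s = A ×ˢ Set.Ioi a}

/-- The predictable `σ`-algebra on `Ω × ℝ` of a filtration indexed by the real line. -/
abbrev predictableSpace (ℱ : Filtration ℝ mΩ) : MeasurableSpace (Ω × ℝ) :=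
  MeasurableSpace.generateFrom (predictableRectangles ℱ)

variable {ℱ : Filtration ℝ mΩ}

theorem measurableSet_predictableSpace_prod_Ioi {a : ℝ} {A : Set Ω} (hA : MeasurableSet[ℱ a] A) :
    MeasurableSet[predictableSpace ℱ] (A ×ˢ Set.Ioi a) :=
  MeasurableSpace.measurableSet_generateFrom ⟨a, A, hA, rfl⟩

theorem predictableSpace_le : predictableSpace ℱ ≤ Prod.instMeasurableSpace :=
  MeasurableSpace.generateFrom_le fun _ ⟨a, _, hA, hs⟩ =>
    hs ▸ (ℱ.le a _ hA).prod measurableSet_Ioi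

theorem isPiSystem_predictableRectangles : IsPiSystem (predictableRectangles ℱ) := by
  rintro _ ⟨a, A, hA, rfl⟩ _ ⟨b, B, hB, rfl⟩ -
  exact ⟨max a b, A ∩ B,
    (ℱ.mono (le_max_left a b) _ hA).inter (ℱ.mono (le_max_right a b) _ hB),
    by rw [Set.prod_inter_prod, Set.Ioi_inter_Ioi]⟩

theorem measurable_predictableSpace_snd : Measurable[predictableSpace ℱ] (Prod.snd : Ω × ℝ → ℝ) :=
  measurable_of_Ioi fun a => by
    simpa only [Set.univ_prod] using measurableSet_predictableSpace_prod_Ioi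
      (ℱ := ℱ) (a := a) (@MeasurableSet.univ Ω (ℱ a))

theorem measurable_predictableSpace_fst {E : Type*} [MeasurableSpace E] {f : Ω → E}
    (hf : ∀ a, Measurable[ℱ a] f) : Measurable[predictableSpace ℱ] fun p : Ω × ℝ => f p.1 := by
  intro s hs
  have hunion : (fun p : Ω × ℝ => f p.1) ⁻¹' s =
      ⋃ k : ℕ, (f ⁻¹' s) ×ˢ Set.Ioi (-(k : ℝ)) := by
    ext ⟨ω, u⟩
    obtain ⟨k, hk⟩ := exists_nat_gt (-u)
    simp only [Set.mem_preimage, Set.mem_iUnion, Set.mem_prod, Set.mem_Ioi, exists_and_left,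
      iff_self_and]
    exact fun _ => ⟨k, by linarith⟩
  rw [hunion]
  exact MeasurableSet.iUnion fun k => measurableSet_predictableSpace_prod_Ioi (hf _ hs)

theorem measurableSet_predictableSpace_lt_ofReal {X : Ω → ℝ≥0∞}
    (hX : ∀ a, MeasurableSet[ℱ a] {ω | X ω < ENNReal.ofReal a}) :
    MeasurableSet[predictableSpace ℱ] {p : Ω × ℝ | X p.1 < ENNReal.ofReal p.2} := by
  have hunion : {p : Ω × ℝ | X p.1 < ENNReal.ofReal p.2} =
      ⋃ a : ℚ, {ω | X ω < ENNReal.ofReal a} ×ˢ Set.Ioi (a : ℝ) := by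
    ext ⟨ω, u⟩
    simp only [Set.mem_ofPred_eq, Set.mem_iUnion, Set.mem_prod, Set.mem_Ioi]
    refine ⟨fun h => ?_, fun ⟨a, hXa, hau⟩ => hXa.trans_le (ENNReal.ofReal_le_ofReal hau.le)⟩
    obtain ⟨a, hXa, hau⟩ := exists_rat_btwn (((ENNReal.lt_ofReal_iff_toReal_lt h.ne_top).1 h))
    exact ⟨a, (ENNReal.lt_ofReal_iff_toReal_lt h.ne_top).2 hXa, hau⟩
  rw [hunion]
  exact MeasurableSet.iUnion fun a => measurableSet_predictableSpace_prod_Ioi (hX a)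

theorem trim_predictableSpace_eq {μ ν : Measure (Ω × ℝ)} [IsFiniteMeasure μ] {τ : ℝ}
    (hμ : ∀ᵐ p ∂μ, p.2 ∈ Set.Ioc 0 τ) (hν : ∀ᵐ p ∂ν, p.2 ∈ Set.Ioc 0 τ)
    (h : ∀ a ∈ Set.Ico 0 τ, ∀ A, MeasurableSet[ℱ a] A → μ (A ×ˢ Set.Ioi a) = ν (A ×ˢ Set.Ioi a)) :
    μ.trim (predictableSpace_le (ℱ := ℱ)) = ν.trim (predictableSpace_le (ℱ := ℱ)) := by
  have hcarried : ∀ (a : ℝ) (A : Set Ω) (ρ : Measure (Ω × ℝ)), (∀ᵐ p ∂ρ, p.2 ∈ Set.Ioc 0 τ) →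
      ρ (A ×ˢ Set.Ioi a) = if max a 0 < τ then ρ (A ×ˢ Set.Ioi (max a 0)) else 0 := by
    intro a A ρ hρ
    split_ifs with haτ
    · refine measure_congr (hρ.mono fun p hp => ?_)
      have hp0 : max a 0 < p.2 ↔ a < p.2 := by rw [max_lt_iff, and_iff_left hp.1]
      exact propext (and_congr_right fun _ => hp0.symm)
    · exact measure_eq_zero_iff_ae_notMem.2 <| hρ.mono fun p hpτ hp =>
        haτ ((max_lt hp.2 hpτ.1).trans_le hpτ.2)
  refine @Measure.ext_of_generateFrom_of_iUnion _ (predictableSpace ℱ) _ _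
    (predictableRectangles ℱ) (fun k : ℕ => Set.univ ×ˢ Set.Ioi (-(k : ℝ))) rfl
    isPiSystem_predictableRectangles ?_ (fun k => ⟨_, _, MeasurableSet.univ, rfl⟩)
    (fun k => ?_) ?_
  · refine Set.eq_univ_of_forall fun p => ?_
    obtain ⟨k, hk⟩ := exists_nat_gt (-p.2)
    exact Set.mem_iUnion.2 ⟨k, Set.mem_univ _, by rw [Set.mem_Ioi]; linarith⟩
  · rw [trim_measurableSet_eq _ (measurableSet_predictableSpace_prod_Ioi MeasurableSet.univ)]
    exact measure_ne_top μ _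
  · rintro _ ⟨a, A, hA, rfl⟩
    have hrect := measurableSet_predictableSpace_prod_Ioi hA
    rw [trim_measurableSet_eq _ hrect, trim_measurableSet_eq _ hrect, hcarried a A μ hμ,
      hcarried a A ν hν]
    split_ifs with haτ
    · exact h _ ⟨le_max_right a 0, haτ⟩ A (ℱ.mono (le_max_left a 0) _ hA)
    · rfl

end Predictable

namespace SurvivalSample

variable {m n : ℕ} {Ω : Type*} [mΩ : MeasurableSpace Ω] (D : SurvivalSample m n Ω)

theorem N_nonneg (i : Fin n) (t : ℝ) (ω : Ω) : 0 ≤ D.N i t ω :=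
  Set.indicator_nonneg (fun _ _ => zero_le_one) _

theorem N_le_one (i : Fin n) (t : ℝ) (ω : Ω) : D.N i t ω ≤ 1 :=
  Set.indicator_le' (fun _ _ => le_rfl) (fun _ _ => zero_le_one) _

theorem Y_nonneg (i : Fin n) (t : ℝ) (ω : Ω) : 0 ≤ D.Y i t ω :=
  Set.indicator_nonneg (fun _ _ => zero_le_one) _

theorem Y_le_one (i : Fin n) (t : ℝ) (ω : Ω) : D.Y i t ω ≤ 1 :=
  Set.indicator_le' (fun _ _ => le_rfl) (fun _ _ => zero_le_one) _

theorem integrable_N (P : Measure Ω) [IsFiniteMeasure P] (i : Fin n) (t : ℝ) :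
    Integrable (D.N i t) P :=
  .of_bound (D.measurable_N i t).aestronglyMeasurable 1 <| .of_forall fun ω => by
    rw [Real.norm_of_nonneg (D.N_nonneg i t ω)]; exact D.N_le_one i t ω

theorem N_mul_eq_indicator (i : Fin n) (t : ℝ) (f : Ω → ℝ) (ω : Ω) :
    D.N i t ω * f ω = {ω | D.N i t ω = 1}.indicator f ω := by
  by_cases hω : D.X i ω ≤ ENNReal.ofReal t ∧ D.δ i ω = 1 <;>
    simp [N, Set.indicator_apply, hω]

theorem N_eq_one_iff {i : Fin n} {t : ℝ} {ω : Ω} :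
    D.N i t ω = 1 ↔ D.X i ω ≤ ENNReal.ofReal t ∧ D.δ i ω = 1 := by
  simp [N, Set.indicator_apply]

theorem measurableSet_N_eq_one (i : Fin n) (t : ℝ) : MeasurableSet {ω | D.N i t ω = 1} :=
  D.measurable_N i t (measurableSet_singleton 1)

theorem toReal_X_le_of_N_eq_one {i : Fin n} {t : ℝ} (ht : 0 ≤ t) {ω : Ω} (h : D.N i t ω = 1) :
    (D.X i ω).toReal ≤ t :=
  ENNReal.toReal_le_of_le_ofReal ht (D.N_eq_one_iff.1 h).1

theorem N_sub_N_eq_indicator (i : Fin n) {s t : ℝ} (hs : 0 ≤ s) (hst : s ≤ t) (ω : Ω) :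
    D.N i t ω - D.N i s ω =
      ({ω | D.N i t ω = 1} ∩ {ω | s < (D.X i ω).toReal}).indicator 1 ω := by
  have hlt : D.X i ω ≤ ENNReal.ofReal t → (D.X i ω ≤ ENNReal.ofReal s ↔ ¬ s < (D.X i ω).toReal) :=
    fun hX => by rw [not_lt, ENNReal.le_ofReal_iff_toReal_le (ne_top_of_le_ne_top
      ENNReal.ofReal_ne_top hX) hs]
  have hmono : D.X i ω ≤ ENNReal.ofReal s → D.X i ω ≤ ENNReal.ofReal t :=
    fun hX => hX.trans (ENNReal.ofReal_le_ofReal hst)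
  simp only [N, Set.indicator_apply, Set.mem_inter_iff, Set.mem_ofPred_eq, Pi.one_apply]
  grind

theorem measurable_Y_prod (i : Fin n) : Measurable fun p : Ω × ℝ => D.Y i p.2 p.1 :=
  measurable_one.indicator (measurableSet_le (ENNReal.measurable_ofReal.comp measurable_snd)
    ((D.measurable_X i).comp measurable_fst))

/-- The weights `Y_k(u) exp(βᵀz⁽ᵏ⁾)` of the units at risk. -/
noncomputable def riskWeight (β : EuclideanSpace ℝ (Fin m)) (u : ℝ) (ω : Ω) : Fin n → ℝ :=
  tiltedWeight (fun k => D.Y k u ω) (fun k => D.z k ω) β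

theorem riskWeight_nonneg (β : EuclideanSpace ℝ (Fin m)) (u : ℝ) (ω : Ω) (k : Fin n) :
    0 ≤ D.riskWeight β u ω k :=
  tiltedWeight_nonneg (fun k => D.Y_nonneg k u ω) _ β k

theorem riskWeight_le {ω : Ω} {k : Fin n} {K : ℝ} (hz : ‖D.z k ω‖ ≤ K)
    (β : EuclideanSpace ℝ (Fin m)) (u : ℝ) : D.riskWeight β u ω k ≤ Real.exp (‖β‖ * K) :=
  (mul_le_of_le_one_left (Real.exp_pos _).le (D.Y_le_one k u ω)).trans <|
    Real.exp_le_exp.2 (le_of_abs_le (abs_inner_le_norm_mul hz β))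

/-- The history generated by all covariates and, at time `a`, by the at-risk processes up to `a`;
indexed by the whole real line so that `predictableSpace` applies to it. -/
noncomputable def riskHistory : Filtration ℝ mΩ where
  seq a := ⨆ i, (MeasurableSpace.comap (D.z i) inferInstance ⊔
    ⨆ s, ⨆ _ : s ≤ a, MeasurableSpace.comap (D.Y i s) inferInstance)
  mono' _ _ h := iSup_mono fun _ => sup_le_sup le_rfl <|
    iSup_mono fun _ => iSup_mono' fun hs => ⟨hs.trans h, le_rfl⟩
  le' _ := iSup_le fun i => sup_le (D.measurable_z i).comap_le <|
    iSup_le fun s => iSup_le fun _ => (D.measurable_Y i s).comap_le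

theorem measurable_riskHistory_z (i : Fin n) (a : ℝ) : Measurable[D.riskHistory a] (D.z i) :=
  Measurable.of_comap_le <| le_iSup_of_le i le_sup_left

theorem measurable_riskHistory_Y (i : Fin n) (a : ℝ) : Measurable[D.riskHistory a] (D.Y i a) :=
  Measurable.of_comap_le <| le_iSup_of_le i <| le_sup_of_le_right <|
    le_iSup_of_le a <| le_iSup_of_le le_rfl le_rfl

theorem riskHistory_le_history {τ : ℝ} (a : Set.Icc 0 τ) : D.riskHistory a ≤ D.history τ a := by
  refine iSup_mono fun i => sup_le_sup le_rfl <| iSup_le fun s => iSup_le fun hs => ?_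
  have hY : D.Y i s = D.Y i (max s 0) := by simp [Y]
  rw [hY]
  exact le_iSup_of_le ⟨max s 0, le_max_right s 0, max_le (hs.trans a.2.2) (a.2.1.trans a.2.2)⟩ <|
    le_iSup_of_le (max_le hs a.2.1) le_sup_right

theorem measurable_predictable_z (i : Fin n) :
    Measurable[predictableSpace D.riskHistory] fun p : Ω × ℝ => D.z i p.1 :=
  measurable_predictableSpace_fst (D.measurable_riskHistory_z i)

theorem measurable_predictable_Y (i : Fin n) :
    Measurable[predictableSpace D.riskHistory] fun p : Ω × ℝ => D.Y i p.2 p.1 := by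
  have hX : ∀ a, MeasurableSet[D.riskHistory a] {ω | D.X i ω < ENNReal.ofReal a} := fun a => by
    convert D.measurable_riskHistory_Y i a (measurableSet_singleton 0) using 1
    ext ω
    simp [Y, Set.indicator_apply]
  have hrisk : (fun p : Ω × ℝ => D.Y i p.2 p.1) =
      {p : Ω × ℝ | D.X i p.1 < ENNReal.ofReal p.2}ᶜ.indicator 1 := by
    ext p
    simp [Y, Set.indicator_apply]
  rw [hrisk]
  exact Measurable.indicator (m := predictableSpace D.riskHistory) measurable_const
    (measurableSet_predictableSpace_lt_ofReal hX).compl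

/-- The intensities of the `N_i` on `(0, τ]` are `Y_i(u) q(u, z⁽ⁱ⁾) λ(u)`, where `q` differs from
the relative risk `exp(βᵀz)` of the Cox model by a relative error of at most `r`; the covariates
are bounded by `K`. As `HasIntensity` only concerns the increments of `N_i`, failures at time `0`
have to be excluded separately. -/
structure IsNearCox (P : Measure Ω) (lam : ℝ → ℝ) (τ : ℝ) (β : EuclideanSpace ℝ (Fin m))
    (K r : ℝ) (q : ℝ → EuclideanSpace ℝ (Fin m) → ℝ) : Prop where
  hasIntensity : D.HasIntensity P τ fun u z => q u z * lam u
  measurable : Measurable (Function.uncurry q)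
  abs_sub_le : ∀ u ∈ Set.Ioc 0 τ, ∀ z, ‖z‖ ≤ K →
    |q u z - Real.exp (inner ℝ β z)| ≤ r * Real.exp (inner ℝ β z)
  nonneg : 0 ≤ K
  norm_le : ∀ i, ∀ᵐ ω ∂P, ‖D.z i ω‖ ≤ K
  N_zero : ∀ i, ∀ᵐ ω ∂P, D.N i 0 ω = 0

/-- The law of the outcome together with the failure time of unit `i`, restricted to the event that
this failure is observed in `[0, τ]`. -/
noncomputable def failureMeasure (P : Measure Ω) (τ : ℝ) (i : Fin n) : Measure (Ω × ℝ) :=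
  (P.restrict {ω | D.N i τ ω = 1}).map fun ω => (ω, (D.X i ω).toReal)

/-- The measure `Y_i(u) q(u, z⁽ⁱ⁾) P(dω) dΛ(u)` on `Ω × (0, τ]`. -/
noncomputable def compensatorMeasure (P : Measure Ω) (lam : ℝ → ℝ) (τ : ℝ)
    (q : ℝ → EuclideanSpace ℝ (Fin m) → ℝ) (i : Fin n) : Measure (Ω × ℝ) :=
  (P.prod (hazardMeasure lam τ)).withDensity
    fun p => ENNReal.ofReal (D.Y i p.2 p.1 * q p.2 (D.z i p.1))

theorem measurable_prodMk_toReal_X (i : Fin n) : Measurable fun ω => (ω, (D.X i ω).toReal) :=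
  measurable_id.prodMk (D.measurable_X i).ennreal_toReal

variable {D} {P : Measure Ω} {lam : ℝ → ℝ} {τ : ℝ}
  {β : EuclideanSpace ℝ (Fin m)} {K r : ℝ} {q : ℝ → EuclideanSpace ℝ (Fin m) → ℝ}

theorem ae_failureMeasure_mem_Ioc (hτ : 0 ≤ τ) (i : Fin n) (h0 : ∀ᵐ ω ∂P, D.N i 0 ω = 0) :
    ∀ᵐ p ∂D.failureMeasure P τ i, p.2 ∈ Set.Ioc 0 τ := by
  refine (ae_map_iff (D.measurable_prodMk_toReal_X i).aemeasurable
    (measurable_snd measurableSet_Ioc)).2 ?_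
  refine (ae_restrict_iff' (D.measurableSet_N_eq_one i τ)).2 ?_
  filter_upwards [h0] with ω hω0 hωτ
  refine ⟨ENNReal.toReal_nonneg.lt_of_ne' fun hX => ?_, D.toReal_X_le_of_N_eq_one hτ hωτ⟩
  have hjump := D.N_sub_N_eq_indicator i le_rfl hτ ω
  rw [hω0, hωτ, Set.indicator_of_notMem fun h => h.2.ne' hX] at hjump
  norm_num at hjump

theorem failureMeasure_prod_Ioi [IsFiniteMeasure P] (i : Fin n) {a : ℝ} (ha : 0 ≤ a) (haτ : a ≤ τ)
    {A : Set Ω} (hA : MeasurableSet A) : D.failureMeasure P τ i (A ×ˢ Set.Ioi a) =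
      ENNReal.ofReal (∫ ω in A, (D.N i τ ω - D.N i a ω) ∂P) := by
  have hjump : MeasurableSet ({ω | D.N i τ ω = 1} ∩ {ω | a < (D.X i ω).toReal}) :=
    (D.measurableSet_N_eq_one i τ).inter
      (measurableSet_lt measurable_const (D.measurable_X i).ennreal_toReal)
  have hrect := hA.prod (measurableSet_Ioi (a := a))
  simp only [D.N_sub_N_eq_indicator i ha haτ]
  rw [integral_indicator_one hjump, measureReal_def, Measure.restrict_apply hjump,
    ENNReal.ofReal_toReal (measure_ne_top _ _), failureMeasure,
    Measure.map_apply (D.measurable_prodMk_toReal_X i) hrect,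
    Measure.restrict_apply (D.measurable_prodMk_toReal_X i hrect)]
  congr 1
  ext ω
  exact ⟨fun h => ⟨⟨h.2, h.1.2⟩, h.1.1⟩, fun h => ⟨⟨h.2, h.1.2⟩, h.1.1⟩⟩

theorem IsNearCox.error_nonneg (h : D.IsNearCox P lam τ β K r q) (hτ : 0 < τ) : 0 ≤ r := by
  simpa using (abs_nonneg _).trans (h.abs_sub_le τ ⟨hτ, le_rfl⟩ 0 (by simpa using h.nonneg))

theorem IsNearCox.ae_prod (h : D.IsNearCox P lam τ β K r q) (i : Fin n) :
    ∀ᵐ p ∂P.prod (hazardMeasure lam τ), p.2 ∈ Set.Ioc 0 τ ∧ ‖D.z i p.1‖ ≤ K :=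
  (Measure.quasiMeasurePreserving_snd.ae ae_hazardMeasure_mem_Ioc).and
    (Measure.quasiMeasurePreserving_fst.ae (h.norm_le i))

theorem IsNearCox.measurable_Y_mul (h : D.IsNearCox P lam τ β K r q) (i : Fin n) :
    Measurable fun p : Ω × ℝ => D.Y i p.2 p.1 * q p.2 (D.z i p.1) :=
  (D.measurable_Y_prod i).mul <|
    h.measurable.comp (measurable_snd.prodMk ((D.measurable_z i).comp measurable_fst))

theorem IsNearCox.ae_abs_Y_mul_sub_riskWeight_le (h : D.IsNearCox P lam τ β K r q) (i : Fin n) :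
    ∀ᵐ p ∂P.prod (hazardMeasure lam τ), |D.Y i p.2 p.1 * q p.2 (D.z i p.1) -
      D.riskWeight β p.2 p.1 i| ≤ r * D.riskWeight β p.2 p.1 i := by
  filter_upwards [h.ae_prod i] with p ⟨hu, hz⟩
  rw [riskWeight, tiltedWeight, ← mul_sub, abs_mul, abs_of_nonneg (D.Y_nonneg i _ _),
    mul_left_comm]
  exact mul_le_mul_of_nonneg_left (h.abs_sub_le _ hu _ hz) (D.Y_nonneg i _ _)

theorem IsNearCox.ae_Y_mul_mem_Icc (h : D.IsNearCox P lam τ β K r q) (hr : r ≤ 1) (i : Fin n) :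
    ∀ᵐ p ∂P.prod (hazardMeasure lam τ), D.Y i p.2 p.1 * q p.2 (D.z i p.1) ∈
      Set.Icc 0 (2 * D.riskWeight β p.2 p.1 i) := by
  filter_upwards [h.ae_abs_Y_mul_sub_riskWeight_le i] with p hp
  have hr_mul := mul_le_mul_of_nonneg_right hr (D.riskWeight_nonneg β p.2 p.1 i)
  have hdev := abs_le.1 hp
  exact ⟨by linarith, by linarith⟩

variable [IsProbabilityMeasure P] [IsFiniteMeasure (hazardMeasure lam τ)]

theorem IsNearCox.integrable_Y_mul (h : D.IsNearCox P lam τ β K r q) (hr : r ≤ 1) (i : Fin n) :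
    Integrable (fun p => D.Y i p.2 p.1 * q p.2 (D.z i p.1)) (P.prod (hazardMeasure lam τ)) := by
  refine .of_bound (h.measurable_Y_mul i).aestronglyMeasurable (2 * Real.exp (‖β‖ * K)) ?_
  filter_upwards [h.ae_prod i, h.ae_Y_mul_mem_Icc hr i] with p ⟨_, hz⟩ hY
  rw [Real.norm_of_nonneg hY.1]
  exact hY.2.trans (mul_le_mul_of_nonneg_left (D.riskWeight_le hz β p.2) zero_le_two)

theorem IsNearCox.setIntegral_N_sub_N (h : D.IsNearCox P lam τ β K r q) (hr : r ≤ 1)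
    (hlam : ∀ t, 0 ≤ lam t) (hΛ : IntervalIntegrable lam volume 0 τ) (i : Fin n) {a : ℝ}
    (ha : a ∈ Set.Icc 0 τ) {A : Set Ω} (hA : MeasurableSet[D.riskHistory a] A) :
    ∫ ω in A, (D.N i τ ω - D.N i a ω) ∂P = ∫ ω in A, ∫ u in Set.Ioc a τ,
      D.Y i u ω * q u (D.z i ω) ∂hazardMeasure lam τ ∂P := by
  have hτ : τ ∈ Set.Icc 0 τ := ⟨ha.1.trans ha.2, le_rfl⟩
  have hmartingale := (h.hasIntensity i).setIntegral_eq (i := ⟨a, ha⟩) (j := ⟨τ, hτ⟩) ha.2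
    (D.riskHistory_le_history ⟨a, ha⟩ A hA)
  have hM := fun t => ((h.hasIntensity i).integrable t).integrableOn (s := A)
  have hN := ((D.integrable_N P i τ).sub (D.integrable_N P i a)).integrableOn (s := A)
  rw [← sub_eq_zero, ← integral_sub (hM _) (hM _)] at hmartingale
  rw [← add_zero (∫ ω in A, (D.N i τ ω - D.N i a ω) ∂P), ← hmartingale]
  refine (integral_add hN ((hM _).sub (hM _))).symm.trans (integral_congr_ae (ae_restrict_of_ae ?_))
  filter_upwards [(h.integrable_Y_mul hr i).prod_right_ae] with ω hω
  have hcumulative : ∀ t ∈ Set.Icc 0 τ, ∫ u in (0 : ℝ)..t, D.Y i u ω * (q u (D.z i ω) * lam u) =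
      ∫ u in Set.Ioc 0 t, D.Y i u ω * q u (D.z i ω) ∂hazardMeasure lam τ := fun t ht => by
    simpa only [mul_assoc] using intervalIntegral_mul_eq_setIntegral_hazardMeasure hlam hΛ
      le_rfl ht.1 ht.2 fun u => D.Y i u ω * q u (D.z i ω)
  have hsplit := setIntegral_union (μ := hazardMeasure lam τ) (Set.Ioc_disjoint_Ioc_of_le le_rfl)
    measurableSet_Ioc (hω.integrableOn (s := Set.Ioc 0 a)) (hω.integrableOn (s := Set.Ioc a τ))
  rw [Set.Ioc_union_Ioc_eq_Ioc ha.1 ha.2] at hsplit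
  simp only [Pi.sub_apply, hcumulative a ha, hcumulative τ hτ, hsplit]
  ring

theorem IsNearCox.compensatorMeasure_prod_Ioi (h : D.IsNearCox P lam τ β K r q) (hr : r ≤ 1)
    (i : Fin n) {a : ℝ} {A : Set Ω} (hA : MeasurableSet A) :
    D.compensatorMeasure P lam τ q i (A ×ˢ Set.Ioi a) =
      ENNReal.ofReal (∫ ω in A, ∫ u in Set.Ioc a τ,
        D.Y i u ω * q u (D.z i ω) ∂hazardMeasure lam τ ∂P) := by
  have hint := (h.integrable_Y_mul hr i).integrableOn (s := A ×ˢ Set.Ioi a)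
  rw [compensatorMeasure, withDensity_apply _ (hA.prod measurableSet_Ioi),
    ← ofReal_integral_eq_lintegral_ofReal hint (ae_restrict_of_ae <|
      (h.ae_Y_mul_mem_Icc hr i).mono fun p hp => hp.1), setIntegral_prod _ hint]
  have hcarried : (Set.Ioi a : Set ℝ) =ᵐ[hazardMeasure lam τ] Set.Ioc a τ :=
    ae_hazardMeasure_mem_Ioc.mono fun u hu => propext (and_iff_left hu.2).symm
  simp only [Measure.restrict_congr_set hcarried]

theorem IsNearCox.trim_failureMeasure_eq (h : D.IsNearCox P lam τ β K r q) (hr : r ≤ 1)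
    (hτ : 0 ≤ τ) (hlam : ∀ t, 0 ≤ lam t) (hΛ : IntervalIntegrable lam volume 0 τ) (i : Fin n) :
    (D.failureMeasure P τ i).trim (predictableSpace_le (ℱ := D.riskHistory)) =
      (D.compensatorMeasure P lam τ q i).trim (predictableSpace_le (ℱ := D.riskHistory)) := by
  have : IsFiniteMeasure (D.failureMeasure P τ i) := by
    unfold failureMeasure; infer_instance
  refine trim_predictableSpace_eq (τ := τ) (ae_failureMeasure_mem_Ioc hτ i (h.N_zero i))
    ((withDensity_absolutelyContinuous _ _).ae_le <| (h.ae_prod i).mono fun p hp => hp.1)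
    fun a ha A hA => ?_
  have hA' := D.riskHistory.le a A hA
  rw [failureMeasure_prod_Ioi i ha.1 ha.2.le hA', h.compensatorMeasure_prod_Ioi hr i hA',
    h.setIntegral_N_sub_N hr hlam hΛ i (Set.Ico_subset_Icc_self ha) hA]

theorem IsNearCox.integral_N_mul_eq (h : D.IsNearCox P lam τ β K r q) (hr : r ≤ 1)
    (hτ : 0 ≤ τ) (hlam : ∀ t, 0 ≤ lam t) (hΛ : IntervalIntegrable lam volume 0 τ) (i : Fin n)
    {H : Ω × ℝ → ℝ} (hH : Measurable[predictableSpace D.riskHistory] H) :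
    ∫ ω, D.N i τ ω * H (ω, (D.X i ω).toReal) ∂P =
      ∫ p, D.Y i p.2 p.1 * q p.2 (D.z i p.1) * H p ∂P.prod (hazardMeasure lam τ) := by
  have hH' : StronglyMeasurable[predictableSpace D.riskHistory] H :=
    hH.stronglyMeasurable
  have htrim : ∫ p, H p ∂D.failureMeasure P τ i = ∫ p, H p ∂D.compensatorMeasure P lam τ q i := by
    rw [integral_trim predictableSpace_le hH', integral_trim predictableSpace_le hH',
      h.trim_failureMeasure_eq hr hτ hlam hΛ i]
  have hHm : Measurable H := hH.mono predictableSpace_le le_rfl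
  rw [failureMeasure, integral_map (D.measurable_prodMk_toReal_X i).aemeasurable
    hHm.aestronglyMeasurable, ← integral_indicator (D.measurableSet_N_eq_one i τ),
    compensatorMeasure, integral_withDensity_eq_integral_toReal_smul
      (h.measurable_Y_mul i).ennreal_ofReal (by simp)] at htrim
  simp only [← D.N_mul_eq_indicator] at htrim
  refine htrim.trans (integral_congr_ae ?_)
  filter_upwards [h.ae_Y_mul_mem_Icc hr i] with p hp
  rw [ENNReal.toReal_ofReal hp.1, smul_eq_mul]

end SurvivalSample

section Independence

variable {Ω : Type*} [MeasurableSpace Ω] {P : Measure Ω} [IsProbabilityMeasure P]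

theorem integral_abs_sub_integral_le_sqrt_variance {X : Ω → ℝ} (hX : MemLp X 2 P) :
    ∫ ω, |X ω - ∫ ω', X ω' ∂P| ∂P ≤ √(variance X P) := by
  have hdev : MemLp (fun ω => |X ω - ∫ ω', X ω' ∂P|) 2 P := (hX.sub (memLp_const _)).abs
  have hjensen := variance_nonneg (fun ω => |X ω - ∫ ω', X ω' ∂P|) P
  rw [variance_eq_sub hdev] at hjensen
  simp only [Pi.pow_apply, sq_abs] at hjensen
  rw [variance_eq_integral hX.aemeasurable]
  exact Real.le_sqrt_of_sq_le (sub_nonneg.1 hjensen)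

theorem integral_abs_sum_sub_integral_le {ι : Type*} [Fintype ι] {ξ : ι → Ω → ℝ} {c : ℝ}
    (hc : 0 ≤ c) (hind : Pairwise fun k l => IndepFun (ξ k) (ξ l) P)
    (hm : ∀ k, AEMeasurable (ξ k) P) (hb : ∀ k, ∀ᵐ ω ∂P, |ξ k ω| ≤ c) :
    ∫ ω, |∑ k, (ξ k ω - ∫ ω', ξ k ω' ∂P)| ∂P ≤ c * √(Fintype.card ι) := by
  have hL : ∀ k, MemLp (ξ k) 2 P := fun k => .of_bound (hm k).aestronglyMeasurable c (hb k)
  have hvar : variance (∑ k, ξ k) P ≤ c ^ 2 * Fintype.card ι := by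
    rw [IndepFun.variance_sum (fun k _ => hL k) (fun k _ l _ hkl => hind hkl), mul_comm,
      ← nsmul_eq_mul]
    refine Finset.sum_le_card_nsmul _ _ _ fun k _ => ?_
    refine (variance_le_sq_of_bounded ((hb k).mono fun ω h => abs_le.1 h) (hm k)).trans_eq ?_
    ring
  have hsum := integral_abs_sub_integral_le_sqrt_variance (memLp_finsetSum' Finset.univ
    fun k _ => hL k)
  simp only [Finset.sum_apply] at hsum
  rw [integral_finsetSum _ fun k _ => (hL k).integrable one_le_two] at hsum
  simp only [Finset.sum_sub_distrib]
  calc _ ≤ √(c ^ 2 * Fintype.card ι) := hsum.trans (Real.sqrt_le_sqrt hvar)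
    _ = _ := by rw [Real.sqrt_mul (sq_nonneg c), Real.sqrt_sq hc]

end Independence

namespace SurvivalSample

variable {m n : ℕ} {Ω : Type*} [mΩ : MeasurableSpace Ω] (D : SurvivalSample m n Ω)
  (φ : EuclideanSpace ℝ (Fin m) → ℝ) (β : EuclideanSpace ℝ (Fin m))

/-- The sum `∑ Y_k(u) exp(βᵀz⁽ᵏ⁾) φ(z⁽ᵏ⁾)`; the entries of `S⁽ᵏ⁾` are such sums. -/
noncomputable def riskSum (u : ℝ) (ω : Ω) : ℝ :=
  ∑ k, D.riskWeight β u ω k * φ (D.z k ω)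

/-- The weighted average of `φ(z⁽ᵏ⁾)` over the units at risk, zero when there are none. -/
noncomputable def riskAverage (u : ℝ) (ω : Ω) : ℝ :=
  Finset.univ.centerMass (D.riskWeight β u ω) fun k => φ (D.z k ω)

/-- The ratio of expectations approximated by `riskAverage`; the entries of `e` and
`s⁽²⁾ / s⁽⁰⁾` are of this form. -/
noncomputable def expectedRiskAverage (P : Measure Ω) (u : ℝ) : ℝ :=
  (∫ ω, D.riskSum φ β u ω ∂P) / ∫ ω, D.riskSum 1 β u ω ∂P

/-- The error made when `riskAverage` is replaced by `expectedRiskAverage`. -/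
noncomputable def riskAverageError (P : Measure Ω) (u : ℝ) (ω : Ω) : ℝ :=
  |D.riskAverage φ β u ω - D.expectedRiskAverage φ β P u|

theorem riskSum_one (u : ℝ) (ω : Ω) : D.riskSum 1 β u ω = ∑ k, D.riskWeight β u ω k := by
  simp only [riskSum, Pi.one_apply, mul_one]

theorem riskSum_one_nonneg (u : ℝ) (ω : Ω) : 0 ≤ D.riskSum 1 β u ω := by
  rw [riskSum_one]
  exact Finset.sum_nonneg fun k _ => D.riskWeight_nonneg β u ω k

theorem riskSum_sub_const (c u : ℝ) (ω : Ω) :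
    D.riskSum (fun z => φ z - c) β u ω = D.riskSum φ β u ω - c * D.riskSum 1 β u ω := by
  simp only [riskSum, Pi.one_apply, mul_sub, mul_one, Finset.sum_sub_distrib, ← Finset.sum_mul,
    mul_comm c]

theorem riskSum_const (c u : ℝ) (ω : Ω) : D.riskSum (fun _ => c) β u ω = c * D.riskSum 1 β u ω := by
  simp only [riskSum, Pi.one_apply, mul_one, ← Finset.sum_mul, mul_comm c]

theorem riskAverage_eq_div (u : ℝ) (ω : Ω) :
    D.riskAverage φ β u ω = D.riskSum φ β u ω / D.riskSum 1 β u ω := by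
  rw [riskAverage, centerMass_univ_eq_div, riskSum_one, riskSum]

variable {φ β}

theorem measurable_predictable_riskWeight (k : Fin n) :
    Measurable[predictableSpace D.riskHistory] fun p : Ω × ℝ => D.riskWeight β p.2 p.1 k :=
  (D.measurable_predictable_Y k).mul <|
    (measurable_const.inner measurable_id).exp.comp (D.measurable_predictable_z k)

theorem measurable_predictable_riskSum {ψ : EuclideanSpace ℝ (Fin m) → ℝ → ℝ}
    (hψ : Measurable (Function.uncurry ψ)) : Measurable[predictableSpace D.riskHistory]
      fun p : Ω × ℝ => D.riskSum (fun z => ψ z p.2) β p.2 p.1 :=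
  Finset.measurable_sum _ fun k _ => (D.measurable_predictable_riskWeight k).mul <|
    hψ.comp ((D.measurable_predictable_z k).prodMk measurable_predictableSpace_snd)

theorem measurable_predictable_riskAverage (hφ : Measurable φ) :
    Measurable[predictableSpace D.riskHistory] fun p : Ω × ℝ => D.riskAverage φ β p.2 p.1 := by
  simp only [riskAverage_eq_div]
  exact (D.measurable_predictable_riskSum (ψ := fun z _ => φ z) (hφ.comp measurable_fst)).div
    (D.measurable_predictable_riskSum (ψ := fun _ _ => 1) measurable_const)

theorem measurable_riskSum_prod {ψ : EuclideanSpace ℝ (Fin m) → ℝ → ℝ}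
    (hψ : Measurable (Function.uncurry ψ)) :
    Measurable fun p : Ω × ℝ => D.riskSum (fun z => ψ z p.2) β p.2 p.1 :=
  (D.measurable_predictable_riskSum hψ).mono predictableSpace_le le_rfl

theorem measurable_riskSum (hφ : Measurable φ) (u : ℝ) : Measurable (D.riskSum φ β u) := by
  simpa only [Function.comp_def] using (D.measurable_riskSum_prod (ψ := fun z _ => φ z)
    (hφ.comp measurable_fst)).comp (measurable_prodMk_right (y := u))

theorem measurable_expectedRiskAverage (hφ : Measurable φ) (P : Measure Ω) [SFinite P] :
    Measurable (D.expectedRiskAverage φ β P) := by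
  have hintegral : ∀ {f : EuclideanSpace ℝ (Fin m) → ℝ}, Measurable f →
      Measurable fun u => ∫ ω, D.riskSum f β u ω ∂P := fun {f} hf =>
    (D.measurable_riskSum_prod (ψ := fun z _ => f z)
      (hf.comp measurable_fst)).stronglyMeasurable.integral_prod_left'.measurable
  exact (hintegral hφ).div (hintegral measurable_const)

variable {D} {K M : ℝ}

theorem abs_riskSum_le (hM : ∀ z, ‖z‖ ≤ K → |φ z| ≤ M) {ω : Ω} (hz : ∀ k, ‖D.z k ω‖ ≤ K)
    (u : ℝ) : |D.riskSum φ β u ω| ≤ M * D.riskSum 1 β u ω := by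
  rw [riskSum, riskSum_one, Finset.mul_sum]
  refine (Finset.abs_sum_le_sum_abs _ _).trans (Finset.sum_le_sum fun k _ => ?_)
  rw [abs_mul, abs_of_nonneg (D.riskWeight_nonneg β u ω k), mul_comm]
  exact mul_le_mul_of_nonneg_right (hM _ (hz k)) (D.riskWeight_nonneg β u ω k)

theorem riskSum_one_le {ω : Ω} (hz : ∀ k, ‖D.z k ω‖ ≤ K) (u : ℝ) :
    D.riskSum 1 β u ω ≤ n * Real.exp (‖β‖ * K) := by
  rw [riskSum_one]
  refine (Finset.sum_le_card_nsmul _ _ _ fun k _ => D.riskWeight_le (hz k) β u).trans_eq ?_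
  rw [Finset.card_univ, Fintype.card_fin, nsmul_eq_mul]

theorem abs_riskAverage_le (hM0 : 0 ≤ M) (hM : ∀ z, ‖z‖ ≤ K → |φ z| ≤ M) {ω : Ω}
    (hz : ∀ k, ‖D.z k ω‖ ≤ K) (u : ℝ) : |D.riskAverage φ β u ω| ≤ M := by
  rw [riskAverage_eq_div, abs_div, abs_of_nonneg (D.riskSum_one_nonneg β u ω)]
  exact div_le_of_le_mul₀ (D.riskSum_one_nonneg β u ω) hM0 (abs_riskSum_le hM hz u)

theorem riskAverage_mul_riskSum_one (hM : ∀ z, ‖z‖ ≤ K → |φ z| ≤ M) {ω : Ω}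
    (hz : ∀ k, ‖D.z k ω‖ ≤ K) (u : ℝ) :
    D.riskAverage φ β u ω * D.riskSum 1 β u ω = D.riskSum φ β u ω := by
  rw [riskAverage_eq_div]
  refine div_mul_cancel_of_imp fun h => abs_nonpos_iff.1 ?_
  simpa only [h, mul_zero] using abs_riskSum_le (β := β) hM hz u

variable {P : Measure Ω} [IsFiniteMeasure P]

theorem integrable_riskSum (hφ : Measurable φ) (hM : ∀ z, ‖z‖ ≤ K → |φ z| ≤ M)
    (hz : ∀ k, ∀ᵐ ω ∂P, ‖D.z k ω‖ ≤ K) (u : ℝ) : Integrable (D.riskSum φ β u) P := by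
  refine .of_bound (D.measurable_riskSum hφ u).aestronglyMeasurable
    (|M| * (n * Real.exp (‖β‖ * K))) ?_
  filter_upwards [ae_all_iff.2 hz] with ω hω
  exact (abs_riskSum_le (fun z h => (hM z h).trans (le_abs_self M)) hω u).trans <|
    mul_le_mul_of_nonneg_left (riskSum_one_le hω u) (abs_nonneg M)

theorem abs_integral_riskSum_le (hM : ∀ z, ‖z‖ ≤ K → |φ z| ≤ M)
    (hz : ∀ k, ∀ᵐ ω ∂P, ‖D.z k ω‖ ≤ K) (u : ℝ) :
    |∫ ω, D.riskSum φ β u ω ∂P| ≤ M * ∫ ω, D.riskSum 1 β u ω ∂P := by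
  rw [← integral_const_mul]
  refine abs_integral_le_integral_abs.trans (integral_mono_of_nonneg
    (.of_forall fun _ => abs_nonneg _)
    ((integrable_riskSum measurable_one (fun _ _ => abs_one.le) hz u).const_mul M) ?_)
  filter_upwards [ae_all_iff.2 hz] with ω hω using abs_riskSum_le hM hω u

theorem abs_expectedRiskAverage_le (hM0 : 0 ≤ M) (hM : ∀ z, ‖z‖ ≤ K → |φ z| ≤ M)
    (hz : ∀ k, ∀ᵐ ω ∂P, ‖D.z k ω‖ ≤ K) (u : ℝ) : |D.expectedRiskAverage φ β P u| ≤ M := by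
  have hmean : 0 ≤ ∫ ω, D.riskSum 1 β u ω ∂P :=
    integral_nonneg fun ω => D.riskSum_one_nonneg β u ω
  rw [expectedRiskAverage, abs_div, abs_of_nonneg hmean]
  exact div_le_of_le_mul₀ hmean hM0 (abs_integral_riskSum_le hM hz u)

theorem expectedRiskAverage_mul_integral (hM : ∀ z, ‖z‖ ≤ K → |φ z| ≤ M)
    (hz : ∀ k, ∀ᵐ ω ∂P, ‖D.z k ω‖ ≤ K) (u : ℝ) :
    D.expectedRiskAverage φ β P u * ∫ ω, D.riskSum 1 β u ω ∂P = ∫ ω, D.riskSum φ β u ω ∂P := by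
  refine div_mul_cancel_of_imp fun h => abs_nonpos_iff.1 ?_
  simpa only [h, mul_zero] using abs_integral_riskSum_le (β := β) hM hz u

theorem integral_riskSum_sub_expectedRiskAverage (hφ : Measurable φ)
    (hM : ∀ z, ‖z‖ ≤ K → |φ z| ≤ M) (hz : ∀ k, ∀ᵐ ω ∂P, ‖D.z k ω‖ ≤ K) (u : ℝ) :
    ∫ ω, D.riskSum (fun z => φ z - D.expectedRiskAverage φ β P u) β u ω ∂P = 0 := by
  have hone := integrable_riskSum (β := β) measurable_one (fun _ _ => abs_one.le) hz u
  simp only [riskSum_sub_const]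
  rw [integral_sub (integrable_riskSum hφ hM hz u) (hone.const_mul _), integral_const_mul,
    expectedRiskAverage_mul_integral hM hz u, sub_self]

end SurvivalSample

namespace SurvivalSample

variable {m n : ℕ} {Ω : Type*} [mΩ : MeasurableSpace Ω] {D : SurvivalSample m n Ω}
  {P : Measure Ω} [IsProbabilityMeasure P] {K M : ℝ} {φ : EuclideanSpace ℝ (Fin m) → ℝ}
  {β : EuclideanSpace ℝ (Fin m)}

theorem integral_abs_sum_comp_obs_sub_le (hind : iIndepFun D.obs P)
    {F : ℝ≥0∞ × ℝ × EuclideanSpace ℝ (Fin m) → ℝ} (hF : Measurable F) {c : ℝ} (hc : 0 ≤ c)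
    (hb : ∀ k, ∀ᵐ ω ∂P, |F (D.obs k ω)| ≤ c) :
    ∫ ω, |∑ k, (F (D.obs k ω) - ∫ ω', F (D.obs k ω') ∂P)| ∂P ≤ c * √n := by
  have hobs : ∀ k, Measurable (D.obs k) := fun k =>
    (D.measurable_X k).prodMk ((D.measurable_δ k).prodMk (D.measurable_z k))
  simpa only [Fintype.card_fin, Function.comp_apply] using integral_abs_sum_sub_integral_le hc
    (fun k l hkl => (hind.indepFun hkl).comp hF hF) (fun k => (hF.comp (hobs k)).aemeasurable) hb

theorem integral_abs_riskSum_sub_integral_le (hind : iIndepFun D.obs P) (hφ : Measurable φ)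
    (hM0 : 0 ≤ M) (hM : ∀ z, ‖z‖ ≤ K → |φ z| ≤ M) (hz : ∀ k, ∀ᵐ ω ∂P, ‖D.z k ω‖ ≤ K) (u : ℝ) :
    ∫ ω, |D.riskSum φ β u ω - ∫ ω', D.riskSum φ β u ω' ∂P| ∂P ≤ Real.exp (‖β‖ * K) * M * √n := by
  let F : ℝ≥0∞ × ℝ × EuclideanSpace ℝ (Fin m) → ℝ := fun o =>
    {o | ENNReal.ofReal u ≤ o.1}.indicator 1 o * Real.exp (inner ℝ β o.2.2) * φ o.2.2
  have hF : Measurable F :=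
    ((measurable_one.indicator (measurableSet_le measurable_const measurable_fst)).mul
      (by fun_prop)).mul (hφ.comp (by fun_prop))
  have hb : ∀ k, ∀ᵐ ω ∂P, |D.riskWeight β u ω k * φ (D.z k ω)| ≤ Real.exp (‖β‖ * K) * M := by
    intro k
    filter_upwards [hz k] with ω hω
    rw [abs_mul, abs_of_nonneg (D.riskWeight_nonneg β u ω k)]
    exact mul_le_mul (D.riskWeight_le hω β u) (hM _ hω) (abs_nonneg _) (Real.exp_pos _).le
  have hint : ∀ k, Integrable (fun ω => D.riskWeight β u ω k * φ (D.z k ω)) P := fun k =>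
    .of_bound (hF.comp ((D.measurable_X k).prodMk
      ((D.measurable_δ k).prodMk (D.measurable_z k)))).aestronglyMeasurable _ (hb k)
  simp only [riskSum, integral_finsetSum _ fun k _ => hint k, ← Finset.sum_sub_distrib]
  exact integral_abs_sum_comp_obs_sub_le hind hF (by positivity) hb

theorem integral_riskSum_one_mul_abs_riskAverage_sub_le (hind : iIndepFun D.obs P)
    (hφ : Measurable φ) (hM0 : 0 ≤ M) (hM : ∀ z, ‖z‖ ≤ K → |φ z| ≤ M)
    (hz : ∀ k, ∀ᵐ ω ∂P, ‖D.z k ω‖ ≤ K) (u : ℝ) :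
    ∫ ω, D.riskSum 1 β u ω * |D.riskAverage φ β u ω - D.expectedRiskAverage φ β P u| ∂P ≤
      Real.exp (‖β‖ * K) * (2 * M) * √n := by
  have hcentered := integral_abs_riskSum_sub_integral_le (β := β) hind
    (hφ.sub_const (D.expectedRiskAverage φ β P u)) (mul_nonneg zero_le_two hM0) (fun z h => by
      linarith [abs_sub (φ z) (D.expectedRiskAverage φ β P u), hM z h,
        abs_expectedRiskAverage_le (β := β) hM0 hM hz u]) hz u
  simp only [integral_riskSum_sub_expectedRiskAverage hφ hM hz u, sub_zero] at hcentered
  refine (integral_congr_ae ?_).trans_le hcentered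
  filter_upwards [ae_all_iff.2 hz] with ω hω
  rw [riskSum_sub_const, ← riskAverage_mul_riskSum_one hM hω, ← sub_mul, abs_mul,
    abs_of_nonneg (D.riskSum_one_nonneg β u ω), mul_comm]

variable {lam : ℝ → ℝ} {τ r : ℝ} {q : ℝ → EuclideanSpace ℝ (Fin m) → ℝ}
  [IsFiniteMeasure (hazardMeasure lam τ)]

theorem IsNearCox.integrable_riskWeight_mul (h : D.IsNearCox P lam τ β K r q) (i : Fin n)
    {H : Ω × ℝ → ℝ} (hH : Measurable H) {B : ℝ}
    (hB : ∀ᵐ p ∂P.prod (hazardMeasure lam τ), |H p| ≤ B) :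
    Integrable (fun p => D.riskWeight β p.2 p.1 i * H p) (P.prod (hazardMeasure lam τ)) := by
  have hw : Measurable fun p : Ω × ℝ => D.riskWeight β p.2 p.1 i :=
    (D.measurable_predictable_riskWeight i).mono predictableSpace_le le_rfl
  refine .of_bound (hw.mul hH).aestronglyMeasurable (Real.exp (‖β‖ * K) * B) ?_
  filter_upwards [h.ae_prod i, hB] with p ⟨_, hz⟩ hp
  rw [norm_mul, Real.norm_of_nonneg (D.riskWeight_nonneg β p.2 p.1 i)]
  exact mul_le_mul (D.riskWeight_le hz β p.2) hp (norm_nonneg _) (Real.exp_pos _).le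

theorem IsNearCox.integral_N_mul_le (h : D.IsNearCox P lam τ β K r q) (hr : r ≤ 1)
    (hτ : 0 ≤ τ) (hlam : ∀ t, 0 ≤ lam t) (hΛ : IntervalIntegrable lam volume 0 τ) (i : Fin n)
    {H : Ω × ℝ → ℝ} (hH : Measurable[predictableSpace D.riskHistory] H) (hH0 : ∀ p, 0 ≤ H p)
    (hint : Integrable (fun p => D.riskWeight β p.2 p.1 i * H p) (P.prod (hazardMeasure lam τ))) :
    ∫ ω, D.N i τ ω * H (ω, (D.X i ω).toReal) ∂P ≤
      2 * ∫ p, D.riskWeight β p.2 p.1 i * H p ∂P.prod (hazardMeasure lam τ) := by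
  rw [h.integral_N_mul_eq hr hτ hlam hΛ i hH, ← integral_const_mul]
  have hIcc := h.ae_Y_mul_mem_Icc hr i
  refine integral_mono_of_nonneg (hIcc.mono fun p hp => mul_nonneg hp.1 (hH0 p))
    (hint.const_mul 2) (hIcc.mono fun p hp => ?_)
  simpa only [mul_assoc] using mul_le_mul_of_nonneg_right hp.2 (hH0 p)

theorem IsNearCox.sum_integral_N_mul_riskAverageError_le (h : D.IsNearCox P lam τ β K r q)
    (hr : r ≤ 1) (hτ : 0 ≤ τ) (hlam : ∀ t, 0 ≤ lam t) (hΛ : IntervalIntegrable lam volume 0 τ)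
    (hind : iIndepFun D.obs P) (hφ : Measurable φ) (hM : ∀ z, ‖z‖ ≤ K → |φ z| ≤ M) :
    ∑ i, ∫ ω, D.N i τ ω * D.riskAverageError φ β P (D.X i ω).toReal ω ∂P ≤
      4 * (Real.exp (‖β‖ * K) * M * √n) * (hazardMeasure lam τ).real Set.univ := by
  have hM0 : 0 ≤ M := (abs_nonneg _).trans (hM 0 (by simpa using h.nonneg))
  let H : Ω × ℝ → ℝ := fun p => D.riskAverageError φ β P p.2 p.1
  have hH : Measurable[predictableSpace D.riskHistory] H :=
    continuous_abs.measurable.comp <| (D.measurable_predictable_riskAverage hφ).sub <|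
      (D.measurable_expectedRiskAverage hφ P).comp measurable_predictableSpace_snd
  have hint : ∀ i, Integrable (fun p => D.riskWeight β p.2 p.1 i * H p)
      (P.prod (hazardMeasure lam τ)) := fun i => by
    refine h.integrable_riskWeight_mul i (hH.mono predictableSpace_le le_rfl) (B := 2 * M) ?_
    filter_upwards [ae_all_iff.2 h.ae_prod] with p hp
    refine (abs_abs _).trans_le ?_
    linarith [abs_sub (D.riskAverage φ β p.2 p.1) (D.expectedRiskAverage φ β P p.2),
      abs_riskAverage_le (β := β) hM0 hM (fun k => (hp k).2) p.2,
      abs_expectedRiskAverage_le (β := β) hM0 hM h.norm_le p.2]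
  have hsum : Integrable (fun p => D.riskSum 1 β p.2 p.1 * H p) (P.prod (hazardMeasure lam τ)) := by
    simp only [riskSum_one, Finset.sum_mul]
    exact integrable_finsetSum Finset.univ fun i _ => hint i
  calc _ ≤ ∑ i, 2 * ∫ p, D.riskWeight β p.2 p.1 i * H p ∂P.prod (hazardMeasure lam τ) :=
        Finset.sum_le_sum fun i _ =>
          h.integral_N_mul_le hr hτ hlam hΛ i hH (fun _ => abs_nonneg _) (hint i)
    _ = 2 * ∫ u, ∫ ω, D.riskSum 1 β u ω * H (ω, u) ∂P ∂hazardMeasure lam τ := by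
        rw [← Finset.mul_sum, ← integral_finsetSum _ fun i _ => hint i,
          ← integral_prod_symm _ hsum]
        simp only [riskSum_one, Finset.sum_mul]
    _ ≤ 2 * ∫ _, Real.exp (‖β‖ * K) * (2 * M) * √n ∂hazardMeasure lam τ :=
        mul_le_mul_of_nonneg_left (integral_mono hsum.integral_prod_right (integrable_const _)
          fun u => integral_riskSum_one_mul_abs_riskAverage_sub_le hind hφ hM0 hM h.norm_le u)
          zero_le_two
    _ = _ := by rw [integral_const, smul_eq_mul]; ring

theorem IsNearCox.abs_integral_N_mul_sub_le (h : D.IsNearCox P lam τ β K r q) (hr : r ≤ 1)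
    (hτ : 0 < τ) (hlam : ∀ t, 0 ≤ lam t) (hΛ : IntervalIntegrable lam volume 0 τ) (i : Fin n)
    {H : Ω × ℝ → ℝ} (hH : Measurable[predictableSpace D.riskHistory] H)
    (hM : ∀ᵐ p ∂P.prod (hazardMeasure lam τ), |H p| ≤ M) :
    |∫ ω, D.N i τ ω * H (ω, (D.X i ω).toReal) ∂P -
        ∫ p, D.riskWeight β p.2 p.1 i * H p ∂P.prod (hazardMeasure lam τ)| ≤
      r * Real.exp (‖β‖ * K) * M * (hazardMeasure lam τ).real Set.univ := by
  have hH' : Measurable H := hH.mono predictableSpace_le le_rfl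
  rw [h.integral_N_mul_eq hr hτ.le hlam hΛ i hH, ← integral_sub
    ((h.integrable_Y_mul hr i).mul_bdd hH'.aestronglyMeasurable hM)
    (h.integrable_riskWeight_mul i hH' hM), ← Real.norm_eq_abs]
  refine (norm_integral_le_of_norm_le_const (C := r * Real.exp (‖β‖ * K) * M) ?_).trans_eq
    (by simp [measureReal_def, ← Set.univ_prod_univ])
  filter_upwards [h.ae_abs_Y_mul_sub_riskWeight_le i, h.ae_prod i, hM] with p hq ⟨_, hz⟩ hp
  rw [← sub_mul, norm_mul]
  exact mul_le_mul (hq.trans (mul_le_mul_of_nonneg_left (D.riskWeight_le hz β p.2)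
    (h.error_nonneg hτ))) hp (norm_nonneg _) (mul_nonneg (h.error_nonneg hτ) (Real.exp_pos _).le)

theorem IsNearCox.abs_sum_integral_N_mul_sub_le (h : D.IsNearCox P lam τ β K r q)
    (hr : r ≤ 1) (hτ : 0 < τ) (hlam : ∀ t, 0 ≤ lam t) (hΛ : IntervalIntegrable lam volume 0 τ)
    {ψ : EuclideanSpace ℝ (Fin m) → ℝ → ℝ} (hψ : Measurable (Function.uncurry ψ))
    (hM : ∀ u z, ‖z‖ ≤ K → |ψ z u| ≤ M) :
    |∑ i, ∫ ω, D.N i τ ω * ψ (D.z i ω) (D.X i ω).toReal ∂P -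
        ∫ p, D.riskSum (fun z => ψ z p.2) β p.2 p.1 ∂P.prod (hazardMeasure lam τ)| ≤
      n * (r * Real.exp (‖β‖ * K) * M * (hazardMeasure lam τ).real Set.univ) := by
  have hH : ∀ i, Measurable[predictableSpace D.riskHistory]
      fun p : Ω × ℝ => ψ (D.z i p.1) p.2 := fun i =>
    hψ.comp ((D.measurable_predictable_z i).prodMk measurable_predictableSpace_snd)
  have hHM : ∀ i, ∀ᵐ p ∂P.prod (hazardMeasure lam τ), |ψ (D.z i p.1) p.2| ≤ M :=
    fun i => (h.ae_prod i).mono fun p hp => hM _ _ hp.2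
  simp only [riskSum]
  rw [integral_finsetSum _ fun i _ => h.integrable_riskWeight_mul i
    ((hH i).mono predictableSpace_le le_rfl) (hHM i), ← Finset.sum_sub_distrib]
  refine (Finset.abs_sum_le_sum_abs _ _).trans ((Finset.sum_le_card_nsmul _ _ _ fun i _ =>
    h.abs_integral_N_mul_sub_le hr hτ hlam hΛ i (hH i) (hHM i)).trans_eq ?_)
  rw [Finset.card_univ, Fintype.card_fin, nsmul_eq_mul]

theorem integrable_N_mul_comp_obs (D : SurvivalSample m n Ω)
    {ψ : EuclideanSpace ℝ (Fin m) → ℝ → ℝ} (hψ : Measurable (Function.uncurry ψ))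
    (hM : ∀ u z, ‖z‖ ≤ K → |ψ z u| ≤ M) {i : Fin n} (hz : ∀ᵐ ω ∂P, ‖D.z i ω‖ ≤ K) (t : ℝ) :
    Integrable (fun ω => D.N i t ω * ψ (D.z i ω) (D.X i ω).toReal) P :=
  (D.integrable_N P i t).mul_bdd (hψ.comp ((D.measurable_z i).prodMk
    (D.measurable_X i).ennreal_toReal)).aestronglyMeasurable (hz.mono fun _ hω => hM _ _ hω)

theorem IsNearCox.integral_abs_sum_N_mul_sub_le (h : D.IsNearCox P lam τ β K r q)
    (hr : r ≤ 1) (hτ : 0 < τ) (hlam : ∀ t, 0 ≤ lam t) (hΛ : IntervalIntegrable lam volume 0 τ)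
    (hind : iIndepFun D.obs P) {ψ : EuclideanSpace ℝ (Fin m) → ℝ → ℝ}
    (hψ : Measurable (Function.uncurry ψ)) (hM : ∀ u z, ‖z‖ ≤ K → |ψ z u| ≤ M) :
    ∫ ω, |∑ i, D.N i τ ω * ψ (D.z i ω) (D.X i ω).toReal -
        ∫ p, D.riskSum (fun z => ψ z p.2) β p.2 p.1 ∂P.prod (hazardMeasure lam τ)| ∂P ≤
      M * √n + n * (r * Real.exp (‖β‖ * K) * M * (hazardMeasure lam τ).real Set.univ) := by
  have hM0 : 0 ≤ M := (abs_nonneg _).trans (hM 0 0 (by simpa using h.nonneg))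
  let F : ℝ≥0∞ × ℝ × EuclideanSpace ℝ (Fin m) → ℝ := fun o =>
    {o | o.1 ≤ ENNReal.ofReal τ ∧ o.2.1 = 1}.indicator 1 o * ψ o.2.2 o.1.toReal
  have hF : Measurable F := (measurable_one.indicator ((measurableSet_le measurable_fst
    measurable_const).inter ((measurable_fst.comp measurable_snd) (measurableSet_singleton 1)))).mul
    (hψ.comp (measurable_snd.snd.prodMk measurable_fst.ennreal_toReal))
  have hb : ∀ i, ∀ᵐ ω ∂P, |D.N i τ ω * ψ (D.z i ω) (D.X i ω).toReal| ≤ M := fun i => by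
    filter_upwards [h.norm_le i] with ω hω
    rw [abs_mul, abs_of_nonneg (D.N_nonneg i τ ω)]
    exact (mul_le_of_le_one_left (abs_nonneg _) (D.N_le_one i τ ω)).trans (hM _ _ hω)
  have hint := fun i => D.integrable_N_mul_comp_obs hψ hM (h.norm_le i) τ
  have hfluctuation := integral_abs_sum_comp_obs_sub_le hind hF hM0 hb
  have hbias := h.abs_sum_integral_N_mul_sub_le hr hτ hlam hΛ hψ hM
  have hdev := (integrable_finsetSum Finset.univ fun i _ =>
    (hint i).sub (integrable_const (∫ ω, D.N i τ ω * ψ (D.z i ω) (D.X i ω).toReal ∂P))).abs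
  set b := ∑ i, ∫ ω, D.N i τ ω * ψ (D.z i ω) (D.X i ω).toReal ∂P -
    ∫ p, D.riskSum (fun z => ψ z p.2) β p.2 p.1 ∂P.prod (hazardMeasure lam τ)
  refine (integral_mono_of_nonneg (.of_forall fun _ => abs_nonneg _)
    (hdev.add (integrable_const |b|)) (.of_forall fun ω => ?_)).trans
    ((integral_add hdev (integrable_const |b|)).trans_le
      (add_le_add hfluctuation (by simpa using hbias)))
  simp only [Pi.add_apply, Pi.sub_apply, Finset.sum_sub_distrib]
  exact _root_.abs_sub_le _ _ _

end SurvivalSample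

theorem integral_abs_sum_mul_sub_le_add {ι Ω : Type*} [Fintype ι] [MeasurableSpace Ω]
    {P : Measure Ω} [IsFiniteMeasure P] {w f g E : ι → Ω → ℝ} (hw : ∀ i ω, 0 ≤ w i ω)
    (hg : ∀ i, Integrable (fun ω => w i ω * g i ω) P) (hE : ∀ i, Integrable (E i) P)
    (hfg : ∀ᵐ ω ∂P, ∀ i, w i ω * |f i ω - g i ω| ≤ E i ω) (T : ℝ) :
    ∫ ω, |∑ i, w i ω * f i ω - T| ∂P ≤
      ∫ ω, |∑ i, w i ω * g i ω - T| ∂P + ∑ i, ∫ ω, E i ω ∂P := by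
  have hmain : Integrable (fun ω => |∑ i, w i ω * g i ω - T|) P :=
    ((integrable_finsetSum _ fun i _ => hg i).sub (integrable_const T)).abs
  have hsum : Integrable (fun ω => ∑ i, E i ω) P := integrable_finsetSum _ fun i _ => hE i
  rw [← integral_finsetSum _ fun i _ => hE i, ← integral_add hmain hsum]
  refine integral_mono_of_nonneg (.of_forall fun _ => abs_nonneg _) (hmain.add hsum) ?_
  filter_upwards [hfg] with ω hω
  refine (abs_sub_le _ (∑ i, w i ω * g i ω) _).trans ?_
  rw [add_comm, ← Finset.sum_sub_distrib]
  refine add_le_add_right ((Finset.abs_sum_le_sum_abs _ _).trans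
    (Finset.sum_le_sum fun i _ => ?_)) _
  rw [← mul_sub, abs_mul, abs_of_nonneg (hw i ω)]
  exact hω i

theorem sum_integral_add_mul_add {ι Ω : Type*} [Fintype ι] [MeasurableSpace Ω] {P : Measure Ω}
    {f g h : ι → Ω → ℝ} (hf : ∀ i, Integrable (f i) P) (hg : ∀ i, Integrable (g i) P)
    (hh : ∀ i, Integrable (h i) P) (c : ℝ) :
    ∑ i, ∫ ω, f i ω + c * (g i ω + h i ω) ∂P =
      ∑ i, ∫ ω, f i ω ∂P + c * (∑ i, ∫ ω, g i ω ∂P + ∑ i, ∫ ω, h i ω ∂P) := by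
  rw [← Finset.sum_add_distrib, Finset.mul_sum, ← Finset.sum_add_distrib]
  refine Finset.sum_congr rfl fun i _ => ?_
  rw [← integral_add (hg i) (hh i), ← integral_const_mul]
  exact integral_add (hf i) (((hg i).add (hh i)).const_mul c)

theorem abs_sub_mul_sub_sub_mul_le {x y z x' y' z' M : ℝ} (hy : |y| ≤ M) (hz' : |z'| ≤ M) :
    |x - y * z - (x' - y' * z')| ≤ |x - x'| + M * (|y - y'| + |z - z'|) := by
  rw [show x - y * z - (x' - y' * z') = (x - x') - ((y - y') * z' + y * (z - z')) by ring,
    mul_add]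
  refine (abs_sub _ _).trans (add_le_add_right ((abs_add_le _ _).trans (add_le_add ?_ ?_)) _)
  · rw [abs_mul, mul_comm]
    exact mul_le_mul_of_nonneg_right hz' (abs_nonneg _)
  · rw [abs_mul]
    exact mul_le_mul_of_nonneg_right hy (abs_nonneg _)

theorem abs_sub_mul_le_two_mul_sq {x y z M : ℝ} (hx : |x| ≤ M ^ 2) (hy : |y| ≤ M) (hz : |z| ≤ M) :
    |x - y * z| ≤ 2 * M ^ 2 := by
  refine (abs_sub _ _).trans ?_
  rw [abs_mul, two_mul]
  refine add_le_add hx ?_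
  rw [sq]
  exact mul_le_mul hy hz (abs_nonneg _) ((abs_nonneg _).trans hy)

theorem abs_mul_apply_le {E : Type*} [NormedAddCommGroup E] {φ χ : E → ℝ} {K M : ℝ} (hM0 : 0 ≤ M)
    (hφ : ∀ z, ‖z‖ ≤ K → |φ z| ≤ M) (hχ : ∀ z, ‖z‖ ≤ K → |χ z| ≤ M) (z : E) (hz : ‖z‖ ≤ K) :
    |(φ * χ) z| ≤ M ^ 2 := by
  rw [Pi.mul_apply, abs_mul, sq]
  exact mul_le_mul (hφ z hz) (hχ z hz) (abs_nonneg _) hM0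

namespace SurvivalSample

variable {m n : ℕ} {Ω : Type*} [mΩ : MeasurableSpace Ω] (D : SurvivalSample m n Ω)
  (φ χ : EuclideanSpace ℝ (Fin m) → ℝ) (β : EuclideanSpace ℝ (Fin m))

/-- The weighted covariance of `φ(z⁽ᵏ⁾)` and `χ(z⁽ᵏ⁾)` over the units at risk. -/
noncomputable def riskCov (u : ℝ) (ω : Ω) : ℝ :=
  weightedCov (D.riskWeight β u ω) (fun k => φ (D.z k ω)) fun k => χ (D.z k ω)

/-- The deterministic function approximated by `riskCov`; the entries of `v` are of this form. -/
noncomputable def expectedRiskCov (P : Measure Ω) (u : ℝ) : ℝ :=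
  D.expectedRiskAverage (φ * χ) β P u -
    D.expectedRiskAverage φ β P u * D.expectedRiskAverage χ β P u

variable {D φ χ β} {K M : ℝ}

theorem measurable_expectedRiskCov (hφ : Measurable φ) (hχ : Measurable χ) (P : Measure Ω)
    [SFinite P] : Measurable (D.expectedRiskCov φ χ β P) :=
  (D.measurable_expectedRiskAverage (hφ.mul hχ) P).sub
    ((D.measurable_expectedRiskAverage hφ P).mul (D.measurable_expectedRiskAverage hχ P))

theorem abs_riskCov_le (hM0 : 0 ≤ M) (hφM : ∀ z, ‖z‖ ≤ K → |φ z| ≤ M)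
    (hχM : ∀ z, ‖z‖ ≤ K → |χ z| ≤ M) {ω : Ω} (hz : ∀ k, ‖D.z k ω‖ ≤ K) (u : ℝ) :
    |D.riskCov φ χ β u ω| ≤ 2 * M ^ 2 :=
  abs_sub_mul_le_two_mul_sq (abs_riskAverage_le (sq_nonneg M) (abs_mul_apply_le hM0 hφM hχM) hz u)
    (abs_riskAverage_le hM0 hφM hz u) (abs_riskAverage_le hM0 hχM hz u)

variable {P : Measure Ω} [IsProbabilityMeasure P]

theorem abs_expectedRiskCov_le (hM0 : 0 ≤ M) (hφM : ∀ z, ‖z‖ ≤ K → |φ z| ≤ M)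
    (hχM : ∀ z, ‖z‖ ≤ K → |χ z| ≤ M) (hz : ∀ k, ∀ᵐ ω ∂P, ‖D.z k ω‖ ≤ K) (u : ℝ) :
    |D.expectedRiskCov φ χ β P u| ≤ 2 * M ^ 2 :=
  abs_sub_mul_le_two_mul_sq
    (abs_expectedRiskAverage_le (sq_nonneg M) (abs_mul_apply_le hM0 hφM hχM) hz u)
    (abs_expectedRiskAverage_le hM0 hφM hz u) (abs_expectedRiskAverage_le hM0 hχM hz u)

theorem abs_riskCov_sub_le (hM0 : 0 ≤ M) (hφM : ∀ z, ‖z‖ ≤ K → |φ z| ≤ M)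
    (hχM : ∀ z, ‖z‖ ≤ K → |χ z| ≤ M) (hz : ∀ k, ∀ᵐ ω ∂P, ‖D.z k ω‖ ≤ K) {ω : Ω}
    (hω : ∀ k, ‖D.z k ω‖ ≤ K) (u : ℝ) :
    |D.riskCov φ χ β u ω - D.expectedRiskCov φ χ β P u| ≤ D.riskAverageError (φ * χ) β P u ω +
      M * (D.riskAverageError φ β P u ω + D.riskAverageError χ β P u ω) :=
  abs_sub_mul_sub_sub_mul_le (abs_riskAverage_le hM0 hφM hω u)
    (abs_expectedRiskAverage_le hM0 hχM hz u)

theorem measurable_riskAverage_X (hφ : Measurable φ) (i : Fin n) :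
    Measurable fun ω => D.riskAverage φ β (D.X i ω).toReal ω := by
  simpa only [Function.comp_def] using ((D.measurable_predictable_riskAverage hφ).mono
    predictableSpace_le le_rfl).comp (D.measurable_prodMk_toReal_X i)

theorem integrable_N_mul_riskAverageError (hφ : Measurable φ) (hM0 : 0 ≤ M)
    (hM : ∀ z, ‖z‖ ≤ K → |φ z| ≤ M) (hz : ∀ k, ∀ᵐ ω ∂P, ‖D.z k ω‖ ≤ K) (i : Fin n) (t : ℝ) :
    Integrable (fun ω => D.N i t ω * D.riskAverageError φ β P (D.X i ω).toReal ω) P := by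
  refine (D.integrable_N P i t).mul_bdd ((measurable_riskAverage_X hφ i).sub
    ((D.measurable_expectedRiskAverage hφ P).comp
      (D.measurable_X i).ennreal_toReal)).abs.aestronglyMeasurable (c := 2 * M) ?_
  filter_upwards [ae_all_iff.2 hz] with ω hω
  refine (abs_abs _).trans_le ?_
  linarith [abs_sub (D.riskAverage φ β (D.X i ω).toReal ω)
    (D.expectedRiskAverage φ β P (D.X i ω).toReal),
    abs_riskAverage_le (β := β) hM0 hM hω (D.X i ω).toReal,
    abs_expectedRiskAverage_le (β := β) hM0 hM hz (D.X i ω).toReal]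

variable {lam : ℝ → ℝ} {τ r : ℝ} {q : ℝ → EuclideanSpace ℝ (Fin m) → ℝ}
  [IsFiniteMeasure (hazardMeasure lam τ)]

theorem IsNearCox.integrable_riskSum_prod (h : D.IsNearCox P lam τ β K r q)
    {ψ : EuclideanSpace ℝ (Fin m) → ℝ → ℝ} (hψ : Measurable (Function.uncurry ψ))
    (hM : ∀ u z, ‖z‖ ≤ K → |ψ z u| ≤ M) :
    Integrable (fun p : Ω × ℝ => D.riskSum (fun z => ψ z p.2) β p.2 p.1)
      (P.prod (hazardMeasure lam τ)) :=
  integrable_finsetSum _ fun i _ => h.integrable_riskWeight_mul i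
    (hψ.comp (((D.measurable_z i).comp measurable_fst).prodMk measurable_snd))
    ((h.ae_prod i).mono fun _ hp => hM _ _ hp.2)

theorem IsNearCox.integral_abs_sum_N_mul_sub_riskAverage_le (h : D.IsNearCox P lam τ β K r q)
    (hr : r ≤ 1) (hτ : 0 < τ) (hlam : ∀ t, 0 ≤ lam t) (hΛ : IntervalIntegrable lam volume 0 τ)
    (hind : iIndepFun D.obs P) (hφ : Measurable φ) (hM : ∀ z, ‖z‖ ≤ K → |φ z| ≤ M) :
    ∫ ω, |∑ i, D.N i τ ω * (φ (D.z i ω) - D.riskAverage φ β (D.X i ω).toReal ω)| ∂P ≤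
      M * ((2 + 12 * (Real.exp (‖β‖ * K) * (hazardMeasure lam τ).real Set.univ)) *
        (√n + n * r)) := by
  have hM0 : 0 ≤ M := (abs_nonneg _).trans (hM 0 (by simpa using h.nonneg))
  let ψ : EuclideanSpace ℝ (Fin m) → ℝ → ℝ := fun z u => φ z - D.expectedRiskAverage φ β P u
  have hψ : Measurable (Function.uncurry ψ) := (hφ.comp measurable_fst).sub
    ((D.measurable_expectedRiskAverage hφ P).comp measurable_snd)
  have hψM : ∀ u z, ‖z‖ ≤ K → |ψ z u| ≤ 2 * M := fun u z hz => by
    linarith [abs_sub (φ z) (D.expectedRiskAverage φ β P u), hM z hz,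
      abs_expectedRiskAverage_le (β := β) hM0 hM h.norm_le u]
  have hmean : ∫ p, D.riskSum (fun z => ψ z p.2) β p.2 p.1 ∂P.prod (hazardMeasure lam τ) = 0 := by
    rw [integral_prod_symm _ (h.integrable_riskSum_prod hψ hψM)]
    simp only [ψ, integral_riskSum_sub_expectedRiskAverage hφ hM h.norm_le, integral_zero]
  have hmain := h.integral_abs_sum_N_mul_sub_le hr hτ hlam hΛ hind hψ hψM
  have hreplace := h.sum_integral_N_mul_riskAverageError_le hr hτ.le hlam hΛ hind hφ hM
  rw [hmean] at hmain
  have hsplit := integral_abs_sum_mul_sub_le_add (P := P) (w := fun i ω => D.N i τ ω)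
    (f := fun i ω => φ (D.z i ω) - D.riskAverage φ β (D.X i ω).toReal ω)
    (g := fun i ω => ψ (D.z i ω) (D.X i ω).toReal) (fun i ω => D.N_nonneg i τ ω)
    (fun i => D.integrable_N_mul_comp_obs hψ hψM (h.norm_le i) τ)
    (fun i => integrable_N_mul_riskAverageError hφ hM0 hM h.norm_le i τ)
    (.of_forall fun ω i => by rw [sub_sub_sub_cancel_left, abs_sub_comm]; rfl) 0
  simp only [sub_zero] at hsplit hmain
  have hr0 := h.error_nonneg hτ
  have hslack : 0 ≤ M * (2 * (n * r) + Real.exp (‖β‖ * K) *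
    (hazardMeasure lam τ).real Set.univ * (8 * √n + 10 * (n * r))) := by positivity
  linarith

theorem IsNearCox.integral_abs_sum_N_mul_expectedRiskCov_sub_le (h : D.IsNearCox P lam τ β K r q)
    (hr : r ≤ 1) (hτ : 0 < τ) (hlam : ∀ t, 0 ≤ lam t) (hΛ : IntervalIntegrable lam volume 0 τ)
    (hind : iIndepFun D.obs P) (hφ : Measurable φ) (hχ : Measurable χ)
    (hφM : ∀ z, ‖z‖ ≤ K → |φ z| ≤ M) (hχM : ∀ z, ‖z‖ ≤ K → |χ z| ≤ M) :
    ∫ ω, |∑ i, D.N i τ ω * D.expectedRiskCov φ χ β P (D.X i ω).toReal - ∫ u,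
        D.expectedRiskCov φ χ β P u * ∫ ω', D.riskSum 1 β u ω' ∂P ∂hazardMeasure lam τ| ∂P ≤
      2 * M ^ 2 * √n +
        n * (r * Real.exp (‖β‖ * K) * (2 * M ^ 2) * (hazardMeasure lam τ).real Set.univ) := by
  have hψ : Measurable (Function.uncurry fun (_ : EuclideanSpace ℝ (Fin m)) u =>
      D.expectedRiskCov φ χ β P u) := (measurable_expectedRiskCov hφ hχ P).comp measurable_snd
  have hψM : ∀ u (z : EuclideanSpace ℝ (Fin m)), ‖z‖ ≤ K →
      |D.expectedRiskCov φ χ β P u| ≤ 2 * M ^ 2 := fun u z hz =>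
    abs_expectedRiskCov_le ((abs_nonneg _).trans (hφM z hz)) hφM hχM h.norm_le u
  have hmain := h.integral_abs_sum_N_mul_sub_le hr hτ hlam hΛ hind hψ hψM
  rw [integral_prod_symm _ (h.integrable_riskSum_prod hψ hψM)] at hmain
  simpa only [riskSum_const, integral_const_mul] using hmain

theorem IsNearCox.integral_abs_sum_N_mul_riskCov_sub_le (h : D.IsNearCox P lam τ β K r q)
    (hr : r ≤ 1) (hτ : 0 < τ) (hlam : ∀ t, 0 ≤ lam t) (hΛ : IntervalIntegrable lam volume 0 τ)
    (hind : iIndepFun D.obs P) (hφ : Measurable φ) (hχ : Measurable χ)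
    (hφM : ∀ z, ‖z‖ ≤ K → |φ z| ≤ M) (hχM : ∀ z, ‖z‖ ≤ K → |χ z| ≤ M) :
    ∫ ω, |∑ i, D.N i τ ω * D.riskCov φ χ β (D.X i ω).toReal ω - ∫ u,
        D.expectedRiskCov φ χ β P u * ∫ ω', D.riskSum 1 β u ω' ∂P ∂hazardMeasure lam τ| ∂P ≤
      M ^ 2 * ((2 + 12 * (Real.exp (‖β‖ * K) * (hazardMeasure lam τ).real Set.univ)) *
        (√n + n * r)) := by
  have hM0 : 0 ≤ M := (abs_nonneg _).trans (hφM 0 (by simpa using h.nonneg))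
  have hprodM := abs_mul_apply_le hM0 hφM hχM
  let err (f : EuclideanSpace ℝ (Fin m) → ℝ) (i : Fin n) (ω : Ω) : ℝ :=
    D.N i τ ω * D.riskAverageError f β P (D.X i ω).toReal ω
  have hprod_err (i : Fin n) : Integrable (err (φ * χ) i) P :=
    integrable_N_mul_riskAverageError (hφ.mul hχ) (sq_nonneg M) hprodM h.norm_le i τ
  have hφ_err (i : Fin n) : Integrable (err φ i) P :=
    integrable_N_mul_riskAverageError hφ hM0 hφM h.norm_le i τ
  have hχ_err (i : Fin n) : Integrable (err χ i) P :=
    integrable_N_mul_riskAverageError hχ hM0 hχM h.norm_le i τ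
  have hreplace := integral_abs_sum_mul_sub_le_add (P := P) (w := fun i ω => D.N i τ ω)
    (f := fun i ω => D.riskCov φ χ β (D.X i ω).toReal ω)
    (g := fun i ω => D.expectedRiskCov φ χ β P (D.X i ω).toReal)
    (E := fun i ω => err (φ * χ) i ω + M * (err φ i ω + err χ i ω))
    (fun i ω => D.N_nonneg i τ ω)
    (fun i => D.integrable_N_mul_comp_obs (ψ := fun _ u => D.expectedRiskCov φ χ β P u)
      ((measurable_expectedRiskCov hφ hχ P).comp measurable_snd)
      (fun u _ _ => abs_expectedRiskCov_le hM0 hφM hχM h.norm_le u) (h.norm_le i) τ)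
    (fun i => (hprod_err i).add (((hφ_err i).add (hχ_err i)).const_mul M))
    ((ae_all_iff.2 h.norm_le).mono fun ω hω i => by
      simp only [err, mul_left_comm M, ← mul_add]
      exact mul_le_mul_of_nonneg_left (abs_riskCov_sub_le hM0 hφM hχM h.norm_le hω _)
        (D.N_nonneg i τ ω))
    (∫ u, D.expectedRiskCov φ χ β P u * ∫ ω', D.riskSum 1 β u ω' ∂P ∂hazardMeasure lam τ)
  rw [sum_integral_add_mul_add hprod_err hφ_err hχ_err] at hreplace
  have herr {f : EuclideanSpace ℝ (Fin m) → ℝ} (hf : Measurable f) {B : ℝ}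
      (hB : ∀ z, ‖z‖ ≤ K → |f z| ≤ B) :=
    h.sum_integral_N_mul_riskAverageError_le hr hτ.le hlam hΛ hind hf hB
  have hr0 := h.error_nonneg hτ
  have hslack : 0 ≤ M ^ 2 * (2 * (n * r) + Real.exp (‖β‖ * K) *
    (hazardMeasure lam τ).real Set.univ * (10 * (n * r))) := by positivity
  linarith [herr (hφ.mul hχ) hprodM, mul_le_mul_of_nonneg_left (herr hφ hφM) hM0,
    mul_le_mul_of_nonneg_left (herr hχ hχM) hM0,
    h.integral_abs_sum_N_mul_expectedRiskCov_sub_le hr hτ hlam hΛ hind hφ hχ hφM hχM]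

end SurvivalSample

section QuadraticForms

variable {ι κ : Type*} [Fintype ι] [Fintype κ]

theorem centerMass_univ_sum_mul (w : κ → ℝ) (c : ι → ℝ) (f : ι → κ → ℝ) :
    (Finset.univ.centerMass w fun k => ∑ a, c a * f a k) =
      ∑ a, c a * Finset.univ.centerMass w (f a) := by
  simp only [Finset.centerMass, smul_eq_mul, Finset.mul_sum]
  rw [Finset.sum_comm]
  exact Finset.sum_congr rfl fun a _ => Finset.sum_congr rfl fun k _ => by ring

theorem weightedCov_comm (w f g : κ → ℝ) : weightedCov w f g = weightedCov w g f := by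
  rw [weightedCov, weightedCov, mul_comm f, mul_comm (Finset.univ.centerMass w f)]

theorem weightedCov_sum_mul_left (w : κ → ℝ) (c : ι → ℝ) (f : ι → κ → ℝ) (g : κ → ℝ) :
    weightedCov w (fun k => ∑ a, c a * f a k) g = ∑ a, c a * weightedCov w (f a) g := by
  have hprod : (fun k => ∑ a, c a * f a k) * g = fun k => ∑ a, c a * (f a * g) k := by
    funext k
    simp only [Pi.mul_apply, Finset.sum_mul, mul_assoc]
  simp only [weightedCov, hprod, centerMass_univ_sum_mul, mul_sub, Finset.sum_sub_distrib,
    Finset.sum_mul, mul_assoc]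

theorem weightedCov_sum_mul_sum_mul (w : κ → ℝ) (c : ι → ℝ) (f : ι → κ → ℝ) :
    weightedCov w (fun k => ∑ a, c a * f a k) (fun k => ∑ a, c a * f a k) =
      c ⬝ᵥ (Matrix.of fun a b => weightedCov w (f a) (f b)).mulVec c := by
  simp only [weightedCov_sum_mul_left, weightedCov_comm w _ fun k => ∑ a, c a * f a k, dotProduct,
    Matrix.mulVec, Matrix.of_apply]
  exact Finset.sum_congr rfl fun a _ => congrArg _ <| Finset.sum_congr rfl fun b _ => by
    rw [weightedCov_comm, mul_comm]

theorem abs_dotProduct_mulVec_le (B : Matrix ι ι ℝ) (x : EuclideanSpace ℝ ι) :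
    |x.ofLp ⬝ᵥ B.mulVec x.ofLp| ≤ (∑ a, ∑ b, |B a b|) * ‖x‖ ^ 2 := by
  simp only [dotProduct, Matrix.mulVec, Finset.mul_sum, Finset.sum_mul]
  refine (Finset.abs_sum_le_sum_abs _ _).trans (Finset.sum_le_sum fun a _ =>
    (Finset.abs_sum_le_sum_abs _ _).trans (Finset.sum_le_sum fun b _ => ?_))
  rw [abs_mul, abs_mul, mul_left_comm, sq]
  exact mul_le_mul_of_nonneg_left (mul_le_mul (PiLp.norm_apply_le x a) (PiLp.norm_apply_le x b)
    (abs_nonneg _) (norm_nonneg _)) (abs_nonneg _)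

theorem euclideanNorm_le_sum_abs (x : EuclideanSpace ℝ ι) : ‖x‖ ≤ ∑ a, |x a| := by
  refine le_of_sq_le_sq ?_ (Finset.sum_nonneg fun a _ => abs_nonneg _)
  rw [EuclideanSpace.real_norm_sq_eq]
  simpa only [sq_abs] using
    Finset.sum_sq_le_sq_sum_of_nonneg (s := Finset.univ) fun a _ => abs_nonneg (x a)

theorem exists_pos_mul_norm_sq_le {E : Type*} [NormedAddCommGroup E] [NormedSpace ℝ E]
    [ProperSpace E] {f : E → ℝ} (hf : Continuous f) (hsmul : ∀ (c : ℝ) x, f (c • x) = c ^ 2 * f x)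
    (hpos : ∀ x, x ≠ 0 → 0 < f x) : ∃ α > 0, ∀ x, α * ‖x‖ ^ 2 ≤ f x := by
  have hzero : f 0 = 0 := by simpa using hsmul 0 0
  cases subsingleton_or_nontrivial E with
  | inl _ => exact ⟨1, one_pos, fun x => by simp [Subsingleton.elim x 0, hzero]⟩
  | inr _ =>
    obtain ⟨x, hx, hmin⟩ := (isCompact_sphere (0 : E) 1).exists_isMinOn
      (NormedSpace.sphere_nonempty.2 zero_le_one) hf.continuousOn
    refine ⟨f x, hpos x (ne_zero_of_mem_unit_sphere ⟨x, hx⟩), fun y => ?_⟩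
    rcases eq_or_ne y 0 with rfl | hy
    · simp [hzero]
    have hunit : f x ≤ f (‖y‖⁻¹ • y) := hmin (by simp [norm_smul, hy])
    rwa [hsmul, inv_pow, inv_mul_eq_div, le_div_iff₀ (by positivity)] at hunit

theorem exists_pos_mul_norm_sq_le_of_posDef {A : Matrix ι ι ℝ} (hA : A.PosDef) :
    ∃ α > 0, ∀ x : EuclideanSpace ℝ ι, α * ‖x‖ ^ 2 ≤ x.ofLp ⬝ᵥ A.mulVec x.ofLp := by
  refine exists_pos_mul_norm_sq_le (by fun_prop) (fun c x => ?_) fun x hx => ?_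
  · simp only [WithLp.ofLp_smul, Matrix.mulVec_smul, smul_dotProduct, dotProduct_smul, smul_eq_mul]
    ring
  · simpa only [star_trivial] using hA.dotProduct_mulVec_pos (x := x.ofLp) (by simpa using hx)

theorem mul_norm_sq_le_of_posSemidef_sub {A B : Matrix ι ι ℝ} (hAB : (B - A).PosSemidef) {α : ℝ}
    {x : EuclideanSpace ℝ ι} (hA : α * ‖x‖ ^ 2 ≤ x.ofLp ⬝ᵥ A.mulVec x.ofLp) :
    α * ‖x‖ ^ 2 ≤ x.ofLp ⬝ᵥ B.mulVec x.ofLp := by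
  have hnonneg := hAB.dotProduct_mulVec_nonneg x.ofLp
  rw [star_trivial, Matrix.sub_mulVec, dotProduct_sub] at hnonneg
  linarith

end QuadraticForms

namespace SurvivalSample

variable {m n : ℕ} {Ω : Type*} [mΩ : MeasurableSpace Ω] (D : SurvivalSample m n Ω)

/-- The observed information `-∂ℓ̇/∂β = ∑ᵢ ∫₀^τ {S⁽²⁾/S⁽⁰⁾ - E Eᵀ} dN_i` of the partial
likelihood. -/
noncomputable def observedInfo (τ : ℝ) (β : EuclideanSpace ℝ (Fin m)) (ω : Ω) :
    Matrix (Fin m) (Fin m) ℝ :=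
  Matrix.of fun a b => ∑ i, D.N i τ ω * D.riskCov (· a) (· b) β (D.X i ω).toReal ω

theorem score_eq_tiltedScore (τ : ℝ) (β : EuclideanSpace ℝ (Fin m)) (ω : Ω) :
    D.score τ β ω = tiltedScore (fun i => D.N i τ ω) (fun i k => D.Y k (D.X i ω).toReal ω)
      (fun k => D.z k ω) β :=
  rfl

theorem score_apply (τ : ℝ) (β : EuclideanSpace ℝ (Fin m)) (ω : Ω) (a : Fin m) :
    D.score τ β ω a =
      ∑ i, D.N i τ ω * (D.z i ω a - D.riskAverage (· a) β (D.X i ω).toReal ω) := by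
  simp only [score_eq_tiltedScore, tiltedScore, Finset.centerMass, riskAverage, riskWeight,
    WithLp.ofLp_sum, WithLp.ofLp_smul, WithLp.ofLp_sub, Finset.sum_apply, Pi.smul_apply,
    Pi.sub_apply, smul_eq_mul]

theorem sum_N_mul_tiltedVariance (τ : ℝ) (β h : EuclideanSpace ℝ (Fin m)) (ω : Ω) :
    ∑ i, D.N i τ ω * tiltedVariance (fun k => D.Y k (D.X i ω).toReal ω) (fun k => D.z k ω) β h =
      h.ofLp ⬝ᵥ (D.observedInfo τ β ω).mulVec h.ofLp := by
  have hinner (x : EuclideanSpace ℝ (Fin m)) : inner ℝ h x = ∑ a, h a * x a := by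
    simp only [PiLp.inner_apply, RCLike.inner_apply, conj_trivial, mul_comm]
  have hsum : D.observedInfo τ β ω = ∑ i, D.N i τ ω •
      Matrix.of fun a b => D.riskCov (· a) (· b) β (D.X i ω).toReal ω := by
    ext a b
    simp only [observedInfo, Matrix.sum_apply, Matrix.smul_apply, Matrix.of_apply, smul_eq_mul]
  rw [hsum, Matrix.sum_mulVec, dotProduct_sum]
  refine Finset.sum_congr rfl fun i _ => ?_
  rw [Matrix.smul_mulVec, dotProduct_smul, smul_eq_mul, tiltedVariance]
  simp only [hinner]
  rw [weightedCov_sum_mul_sum_mul _ _ fun a k => D.z k ω a]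
  rfl

variable {D} {P : Measure Ω} {lam : ℝ → ℝ} {τ K : ℝ}
  {β : EuclideanSpace ℝ (Fin m)}

theorem s0_eq (u : ℝ) : D.s0 P u β = (∫ ω, D.riskSum 1 β u ω ∂P) / n := by
  simp only [s0, S0, riskSum_one, riskWeight, tiltedWeight]

theorem e_apply [IsFiniteMeasure P] (hz : ∀ k, ∀ᵐ ω ∂P, ‖D.z k ω‖ ≤ K) (hn : n ≠ 0) (u : ℝ)
    (a : Fin m) : D.e P u β a = D.expectedRiskAverage (· a) β P u := by
  have hS1 (a : Fin m) (ω : Ω) : D.S1 u β ω a = D.riskSum (· a) β u ω := by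
    simp only [S1, riskSum, riskWeight, tiltedWeight, WithLp.ofLp_sum, Finset.sum_apply,
      PiLp.smul_apply, smul_eq_mul]
  have hs1 : (∫ ω, D.S1 u β ω ∂P) a = ∫ ω, D.riskSum (· a) β u ω ∂P := by
    rw [eval_integral_piLp fun a => ?_]
    · simp only [hS1]
    · simp only [hS1]
      exact integrable_riskSum (by fun_prop) (fun z hz => (PiLp.norm_apply_le z a).trans hz) hz u
  simp only [e, s1, PiLp.smul_apply, smul_eq_mul, hs1, s0_eq, expectedRiskAverage]
  field_simp

theorem v_apply [IsFiniteMeasure P] (hz : ∀ k, ∀ᵐ ω ∂P, ‖D.z k ω‖ ≤ K) (hn : n ≠ 0) (u : ℝ)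
    (a b : Fin m) : D.v P u β a b = D.expectedRiskCov (· a) (· b) β P u := by
  have hs2 : D.s2 P u β a b = (∫ ω, D.riskSum ((· a) * (· b)) β u ω ∂P) / n := by
    simp only [s2, S2, Matrix.of_apply, riskSum, riskWeight, tiltedWeight, Pi.mul_apply, mul_comm]
  simp only [v, Matrix.of_apply, e_apply hz hn, hs2, s0_eq,
    div_div_div_cancel_right₀ (Nat.cast_ne_zero.2 hn : (n : ℝ) ≠ 0)]
  rfl

theorem nat_mul_infoMatrix_apply [IsFiniteMeasure P] (hτ : 0 ≤ τ) (hlam : ∀ t, 0 ≤ lam t)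
    (hΛ : IntervalIntegrable lam volume 0 τ) (hz : ∀ k, ∀ᵐ ω ∂P, ‖D.z k ω‖ ≤ K) (a b : Fin m) :
    n * D.infoMatrix P lam τ β a b = ∫ u, D.expectedRiskCov (· a) (· b) β P u *
      ∫ ω, D.riskSum 1 β u ω ∂P ∂hazardMeasure lam τ := by
  rcases eq_or_ne n 0 with rfl | hn
  · simp [riskSum]
  rw [infoMatrix, Matrix.of_apply,
    intervalIntegral_mul_eq_setIntegral_hazardMeasure hlam hΛ le_rfl hτ le_rfl,
    Measure.restrict_eq_self_of_ae_mem ae_hazardMeasure_mem_Ioc, ← integral_const_mul]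
  simp only [v_apply hz hn, s0_eq]
  congr! 2
  field_simp

end SurvivalSample

namespace SurvivalSample

variable {m n : ℕ} {Ω : Type*} [mΩ : MeasurableSpace Ω] {D : SurvivalSample m n Ω} {P : Measure Ω}
  {lam : ℝ → ℝ} {τ K r : ℝ} {β : EuclideanSpace ℝ (Fin m)}
  {q : ℝ → EuclideanSpace ℝ (Fin m) → ℝ}

variable (D P lam τ β) in
/-- The size of the score at `β` plus the distance of the observed information from its
deterministic approximation `n Σ(β)`. -/
noncomputable def estimationError (ω : Ω) : ℝ :=
  ∑ a, |D.score τ β ω a| +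
    ∑ a, ∑ b, |D.observedInfo τ β ω a b - n * D.infoMatrix P lam τ β a b|

theorem estimationError_nonneg (ω : Ω) : 0 ≤ D.estimationError P lam τ β ω := by
  unfold estimationError
  positivity

theorem existsUniqueNear_score_eq_zero_of_estimationError_lt {ω : Ω} (hz : ∀ k, ‖D.z k ω‖ ≤ K)
    {ε α η : ℝ} (hε : 0 < ε) (hα : 0 < α)
    (hinfo : ∀ h : EuclideanSpace ℝ (Fin m),
      α * ‖h‖ ^ 2 ≤ h.ofLp ⬝ᵥ (D.infoMatrix P lam τ β).mulVec h.ofLp)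
    (hη : 0 < η) (hη_info : η ≤ α / 2) (hη_score : η ≤ Real.exp (-(2 * (ε * K))) * (α / 2 * ε))
    (herr : D.estimationError P lam τ β ω < n * η) :
    ExistsUniqueNear β ε fun β' => D.score τ β' ω = 0 := by
  have hn : (0 : ℝ) < n := (pos_iff_pos_of_mul_pos
    ((estimationError_nonneg ω).trans_lt herr)).2 hη
  have hscore_nonneg : 0 ≤ ∑ a, |D.score τ β ω a| := by positivity
  have hinfo_nonneg :
      0 ≤ ∑ a, ∑ b, |D.observedInfo τ β ω a b - n * D.infoMatrix P lam τ β a b| := by positivity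
  rw [estimationError] at herr
  refine existsUniqueNear_tiltedScore_eq_zero (fun i => D.N_nonneg i τ ω)
    (fun i k => D.Y_nonneg k _ ω) (fun i _ => ⟨i, ?_⟩) hz hε (a := n * (α / 2)) (by positivity)
    (fun h => ?_) ?_
  · rw [Y, Set.indicator_of_mem]
    exacts [one_pos, ENNReal.ofReal_toReal_le]
  · have hdiff := (abs_le.1 (abs_dotProduct_mulVec_le
      (D.observedInfo τ β ω - (n : ℝ) • D.infoMatrix P lam τ β) h)).1
    simp only [Matrix.sub_mulVec, dotProduct_sub, Matrix.smul_mulVec, dotProduct_smul,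
      Matrix.sub_apply, Matrix.smul_apply, smul_eq_mul] at hdiff
    rw [sum_N_mul_tiltedVariance]
    have hcoercive := mul_le_mul_of_nonneg_left (hinfo h) hn.le
    have hperturb := mul_le_mul_of_nonneg_right
      ((le_add_of_nonneg_left hscore_nonneg).trans (herr.le.trans
        (mul_le_mul_of_nonneg_left hη_info hn.le))) (sq_nonneg ‖h‖)
    linarith
  · rw [← score_eq_tiltedScore]
    calc ‖D.score τ β ω‖ ≤ ∑ a, |D.score τ β ω a| := euclideanNorm_le_sum_abs _
      _ < n * η := (le_add_of_nonneg_right hinfo_nonneg).trans_lt herr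
      _ ≤ n * (Real.exp (-(2 * (ε * K))) * (α / 2 * ε)) :=
        mul_le_mul_of_nonneg_left hη_score hn.le
      _ = _ := by ring

variable [IsProbabilityMeasure P]

theorem integrable_score_apply (hK : 0 ≤ K) (hz : ∀ k, ∀ᵐ ω ∂P, ‖D.z k ω‖ ≤ K) (a : Fin m) :
    Integrable (fun ω => D.score τ β ω a) P := by
  simp only [score_apply]
  refine integrable_finsetSum _ fun i _ => (D.integrable_N P i τ).mul_bdd (c := 2 * K)
    (((by fun_prop : Measurable fun z : EuclideanSpace ℝ (Fin m) => z a).comp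
      (D.measurable_z i)).sub (measurable_riskAverage_X (by fun_prop) i)).aestronglyMeasurable ?_
  filter_upwards [ae_all_iff.2 hz] with ω hω
  refine (abs_sub _ _).trans ?_
  have hcoord : ∀ z : EuclideanSpace ℝ (Fin m), ‖z‖ ≤ K → |z a| ≤ K :=
    fun z => (PiLp.norm_apply_le z a).trans
  linarith [hcoord _ (hω i), abs_riskAverage_le (β := β) hK hcoord hω (D.X i ω).toReal]

theorem integrable_observedInfo_apply (hK : 0 ≤ K) (hz : ∀ k, ∀ᵐ ω ∂P, ‖D.z k ω‖ ≤ K)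
    (a b : Fin m) : Integrable (fun ω => D.observedInfo τ β ω a b) P := by
  have hcoord (a : Fin m) : Measurable fun z : EuclideanSpace ℝ (Fin m) => z a := by fun_prop
  simp only [observedInfo, Matrix.of_apply]
  refine integrable_finsetSum _ fun i _ => (D.integrable_N P i τ).mul_bdd (c := 2 * K ^ 2)
    ((measurable_riskAverage_X ((hcoord a).mul (hcoord b)) i).sub
      ((measurable_riskAverage_X (hcoord a) i).mul
        (measurable_riskAverage_X (hcoord b) i))).aestronglyMeasurable ?_
  filter_upwards [ae_all_iff.2 hz] with ω hω
  exact abs_riskCov_le hK (fun z => (PiLp.norm_apply_le z a).trans)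
    (fun z => (PiLp.norm_apply_le z b).trans) hω _

theorem IsNearCox.integral_estimationError_le (h : D.IsNearCox P lam τ β K r q) (hr : r ≤ 1)
    (hτ : 0 < τ) (hlam : ∀ t, 0 ≤ lam t) (hΛ : IntervalIntegrable lam volume 0 τ)
    (hind : iIndepFun D.obs P) : ∫ ω, D.estimationError P lam τ β ω ∂P ≤
      (m * K + m * (m * K ^ 2)) * ((2 + 12 * (Real.exp (‖β‖ * K) *
        (hazardMeasure lam τ).real Set.univ)) * (√n + n * r)) := by
  have := isFiniteMeasure_hazardMeasure hτ.le hΛ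
  have hcoord (a : Fin m) (z : EuclideanSpace ℝ (Fin m)) : ‖z‖ ≤ K → |z a| ≤ K :=
    (PiLp.norm_apply_le z a).trans
  have hscore (a : Fin m) : Integrable (fun ω => |D.score τ β ω a|) P :=
    (integrable_score_apply h.nonneg h.norm_le a).abs
  have hinfo (a b : Fin m) : Integrable
      (fun ω => |D.observedInfo τ β ω a b - n * D.infoMatrix P lam τ β a b|) P :=
    ((integrable_observedInfo_apply h.nonneg h.norm_le a b).sub (integrable_const _)).abs
  simp only [estimationError]
  rw [integral_add (integrable_finsetSum _ fun a _ => hscore a)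
    (integrable_finsetSum _ fun a _ => integrable_finsetSum _ fun b _ => hinfo a b),
    integral_finsetSum _ fun a _ => hscore a,
    integral_finsetSum _ fun a _ => integrable_finsetSum _ fun b _ => hinfo a b]
  simp only [integral_finsetSum _ fun b _ => hinfo _ b]
  set R := (2 + 12 * (Real.exp (‖β‖ * K) * (hazardMeasure lam τ).real Set.univ)) * (√n + n * r)
  have hscore_le (a : Fin m) : ∫ ω, |D.score τ β ω a| ∂P ≤ K * R := by
    simp only [score_apply]
    exact h.integral_abs_sum_N_mul_sub_riskAverage_le hr hτ hlam hΛ hind (by fun_prop) (hcoord a)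
  have hinfo_le (a b : Fin m) :
      ∫ ω, |D.observedInfo τ β ω a b - n * D.infoMatrix P lam τ β a b| ∂P ≤ K ^ 2 * R := by
    simp only [nat_mul_infoMatrix_apply hτ.le hlam hΛ h.norm_le, observedInfo, Matrix.of_apply]
    exact h.integral_abs_sum_N_mul_riskCov_sub_le hr hτ hlam hΛ hind (by fun_prop) (by fun_prop)
      (hcoord a) (hcoord b)
  calc _ ≤ ∑ _ : Fin m, K * R + ∑ _ : Fin m, ∑ _ : Fin m, K ^ 2 * R :=
        add_le_add (Finset.sum_le_sum fun a _ => hscore_le a)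
          (Finset.sum_le_sum fun a _ => Finset.sum_le_sum fun b _ => hinfo_le a b)
    _ = (m * K + m * (m * K ^ 2)) * R := by
        simp only [Finset.sum_const, Finset.card_univ, Fintype.card_fin, nsmul_eq_mul]
        ring

end SurvivalSample

namespace SurvivalSample

variable {m n : ℕ} {Ω : Type*} [mΩ : MeasurableSpace Ω] {D : SurvivalSample m n Ω} {P : Measure Ω}
  [IsProbabilityMeasure P] {lam : ℝ → ℝ} {τ K r : ℝ} {β : EuclideanSpace ℝ (Fin m)}
  {q : ℝ → EuclideanSpace ℝ (Fin m) → ℝ}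

theorem integrable_estimationError (hK : 0 ≤ K) (hz : ∀ k, ∀ᵐ ω ∂P, ‖D.z k ω‖ ≤ K) :
    Integrable (D.estimationError P lam τ β) P :=
  (integrable_finsetSum _ fun a _ => (integrable_score_apply hK hz a).abs).add <|
    integrable_finsetSum _ fun a _ => integrable_finsetSum _ fun b _ =>
      ((integrable_observedInfo_apply hK hz a b).sub (integrable_const _)).abs

theorem measure_not_existsUniqueNear_score_eq_zero_le (hn : n ≠ 0) (hK : 0 ≤ K)
    (hz : ∀ k, ∀ᵐ ω ∂P, ‖D.z k ω‖ ≤ K) {ε α η : ℝ} (hε : 0 < ε) (hα : 0 < α)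
    (hinfo : ∀ h : EuclideanSpace ℝ (Fin m),
      α * ‖h‖ ^ 2 ≤ h.ofLp ⬝ᵥ (D.infoMatrix P lam τ β).mulVec h.ofLp)
    (hη : 0 < η) (hη_info : η ≤ α / 2) (hη_score : η ≤ Real.exp (-(2 * (ε * K))) * (α / 2 * ε)) :
    P {ω | ¬ ExistsUniqueNear β ε fun β' => D.score τ β' ω = 0} ≤
      ENNReal.ofReal ((∫ ω, D.estimationError P lam τ β ω ∂P) / (n * η)) := by
  have hnη : 0 < n * η := by positivity
  have hsub : {ω | ¬ ExistsUniqueNear β ε fun β' => D.score τ β' ω = 0} ≤ᵐ[P]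
      {ω | n * η ≤ D.estimationError P lam τ β ω} := by
    filter_upwards [ae_all_iff.2 hz] with ω hω hnot
    exact not_lt.1 fun herr => hnot <| existsUniqueNear_score_eq_zero_of_estimationError_lt hω hε hα
      hinfo hη hη_info hη_score herr
  refine (measure_mono_ae hsub).trans ?_
  rw [← ofReal_measureReal]
  refine ENNReal.ofReal_le_ofReal ((le_div_iff₀' hnη).2 ?_)
  exact mul_meas_ge_le_integral_of_nonneg (.of_forall estimationError_nonneg)
    (integrable_estimationError hK hz) _

end SurvivalSample

section Convergence

variable {V : Type*} [NormedAddCommGroup V] {Ω : ℕ → Type*} [∀ n, MeasurableSpace (Ω n)]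
  {P : ∀ n, Measure (Ω n)} {p : ∀ n, Ω n → V → Prop} {x : V}

theorem tendsto_measure_existsUnique [∀ n, IsProbabilityMeasure (P n)] {ε : ℝ}
    (h : Tendsto (fun n => P n {ω | ¬ ExistsUniqueNear x ε (p n ω)}) atTop (𝓝 0)) :
    Tendsto (fun n => P n {ω | ∃! y, p n ω y}) atTop (𝓝 1) := by
  have hlower : Tendsto (fun n => 1 - P n {ω | ¬ ExistsUniqueNear x ε (p n ω)}) atTop (𝓝 1) := by
    simpa only [tsub_zero] using
      ENNReal.Tendsto.sub tendsto_const_nhds h (.inl ENNReal.one_ne_top)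
  refine tendsto_of_tendsto_of_tendsto_of_le_of_le hlower tendsto_const_nhds (fun n => ?_)
    fun n => prob_le_one
  rw [tsub_le_iff_right, ← measure_univ (μ := P n)]
  refine (measure_mono fun ω _ => ?_).trans (measure_union_le _ _)
  by_cases hω : ExistsUniqueNear x ε (p n ω)
  · obtain ⟨y, -, hy, huniq⟩ := hω
    exact .inl ⟨y, hy, huniq⟩
  · exact .inr hω

theorem tendsto_measure_le_norm_sub {ε : ℝ}
    (h : Tendsto (fun n => P n {ω | ¬ ExistsUniqueNear x ε (p n ω)}) atTop (𝓝 0))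
    {xhat : ∀ n, Ω n → V}
    (hxhat : ∀ n, ∀ᵐ ω ∂P n, (∃! y, p n ω y) → p n ω (xhat n ω)) :
    Tendsto (fun n => P n {ω | ε ≤ ‖xhat n ω - x‖}) atTop (𝓝 0) := by
  refine tendsto_of_tendsto_of_tendsto_of_le_of_le tendsto_const_nhds h (fun n => zero_le)
    fun n => measure_mono_ae ?_
  filter_upwards [hxhat n] with ω hω hfar hnear
  obtain ⟨y, hyε, hy, huniq⟩ := hnear
  rw [← huniq _ (hω ⟨y, hy, huniq⟩)] at hyε
  exact hyε.not_ge hfar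

end Convergence

theorem tendsto_sqrt_add_nat_mul_div {r : ℕ → ℝ} (hr : Tendsto r atTop (𝓝 0)) (B η : ℝ) :
    Tendsto (fun n : ℕ => B * (√n + n * r n) / (n * η)) atTop (𝓝 0) := by
  have hsqrt : Tendsto (fun n : ℕ => (√n)⁻¹) atTop (𝓝 0) :=
    (Real.tendsto_sqrt_atTop.comp tendsto_natCast_atTop_atTop).inv_tendsto_atTop
  have hlim := (hsqrt.add hr).const_mul (B / η)
  rw [add_zero, mul_zero] at hlim
  refine hlim.congr' ?_
  filter_upwards [eventually_ne_atTop 0] with n hn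
  have hn' : (0 : ℝ) < n := by positivity
  have hsqrt_inv : (√(n : ℝ))⁻¹ = √n / n := by rw [Real.sqrt_div_self', one_div]
  rw [hsqrt_inv, mul_comm (n : ℝ) η, mul_div_mul_comm, add_div, mul_div_cancel_left₀ _ hn'.ne']

namespace SurvivalSample

variable {m n : ℕ} {Ω : Type*} [mΩ : MeasurableSpace Ω] {D : SurvivalSample m n Ω} {P : Measure Ω}
  {lam : ℝ → ℝ} {τ K : ℝ}

theorem HasIntensity.congr {h h' : ℝ → EuclideanSpace ℝ (Fin m) → ℝ} (hD : D.HasIntensity P τ h)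
    (heq : ∀ u ∈ Set.Icc 0 τ, h u = h' u) : D.HasIntensity P τ h' := by
  intro i
  convert hD i using 3 with t ω
  refine congrArg _ (intervalIntegral.integral_congr fun u hu => ?_)
  rw [Set.uIcc_of_le t.2.1] at hu
  simp only [heq u ⟨hu.1, hu.2.trans t.2.2⟩]

variable [IsProbabilityMeasure P]

theorem ae_N_zero_eq_zero_of_hasHazard {h : ℝ → EuclideanSpace ℝ (Fin m) → ℝ} (hτ : 0 ≤ τ)
    (hh : D.HasHazard P τ h) (i : Fin n) : ∀ᵐ ω ∂P, D.N i 0 ω = 0 := by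
  have hcond := hh i 0 (Set.left_mem_Icc.2 hτ)
  simp only [intervalIntegral.integral_same, neg_zero, Real.exp_zero, ENNReal.ofReal_zero] at hcond
  have hmeas : MeasurableSet {ω | 0 < D.T i ω} :=
    measurableSet_lt measurable_const (D.measurable_T i)
  have hprob : P.real {ω | 0 < D.T i ω} = 1 := by
    rw [← integral_indicator_one hmeas, ← integral_condExp (D.measurable_z i).comap_le]
    exact (integral_congr_ae hcond).trans (by simp)
  have hT : ∀ᵐ ω ∂P, 0 < D.T i ω := by
    rw [ae_iff, ← Set.compl_ofPred, ← measureReal_eq_zero_iff, probReal_compl_eq_one_sub hmeas,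
      hprob, sub_self]
  filter_upwards [hT] with ω hω
  refine Set.indicator_of_notMem (fun hN => ?_) _
  obtain ⟨hX, hδ⟩ := hN
  have hTC : D.T i ω ≤ D.C i ω := by
    by_contra hlt
    simp [δ, hlt] at hδ
  rw [X, min_eq_left hTC, ENNReal.ofReal_zero] at hX
  exact hω.not_ge hX

theorem isNearCox_of_hazardRate (hτ : 0 ≤ τ) (hlam : ∀ t, 0 ≤ lam t)
    (hΛ : IntervalIntegrable lam volume 0 τ) (j : Fin m) (β : EuclideanSpace ℝ (Fin m)) (γ : ℝ)
    (hK : 0 ≤ K) (hz : ∀ i, ∀ᵐ ω ∂P, ‖D.z i ω‖ ≤ K)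
    (hhazard : D.HasHazard P τ (hazardRate lam j β γ))
    (hintensity : D.HasIntensity P τ (hazardRate lam j β γ)) :
    D.IsNearCox P lam τ β K (Real.exp (|γ| * K) - 1)
      fun u z => hazardFactor j z (cumHazard lam (Set.projIcc 0 τ hτ u)) β γ where
  hasIntensity := hintensity.congr fun u hu => by
    funext z
    rw [hazardRate, Set.projIcc_of_mem hτ hu]
  measurable := measurable_hazardFactor j measurable_snd
    ((continuous_cumHazard_projIcc hτ hΛ).measurable.comp measurable_fst) β γ
  abs_sub_le u _ z hzK := abs_hazardFactor_sub_le_of_norm_le j hzK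
    (cumHazard_nonneg hlam (Set.projIcc 0 τ hτ u).2.1) β γ
  nonneg := hK
  norm_le := hz
  N_zero := ae_N_zero_eq_zero_of_hasHazard hτ hhazard

end SurvivalSample

theorem tendsto_exp_abs_div_sqrt_mul_sub_one (c K : ℝ) :
    Tendsto (fun n : ℕ => Real.exp (|c / √n| * K) - 1) atTop (𝓝 0) := by
  have hdiv : Tendsto (fun n : ℕ => c / √n) atTop (𝓝 0) :=
    (Real.tendsto_sqrt_atTop.comp tendsto_natCast_atTop_atTop).const_div_atTop c
  simpa using (hdiv.abs.mul_const K).rexp.sub_const 1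

theorem theorem2_general {m : ℕ} (β₀ : EuclideanSpace ℝ (Fin m)) (lam : ℝ → ℝ) (τ K : ℝ)
    (r : ℕ → ℝ) (q : ℕ → ℝ → EuclideanSpace ℝ (Fin m) → ℝ)
    (Ω : ℕ → Type*) [∀ n, MeasurableSpace (Ω n)]
    (P : ∀ n, Measure (Ω n)) [∀ n, IsProbabilityMeasure (P n)]
    (D : ∀ n, SurvivalSample m n (Ω n))
    (hlam : ∀ t, 0 ≤ lam t) (hτ : 0 < τ) (hΛ : IntervalIntegrable lam volume 0 τ)
    (hcox : ∀ n, (D n).IsNearCox (P n) lam τ β₀ K (r n) (q n)) (hr : Tendsto r atTop (𝓝 0))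
    (hind : ∀ n, iIndepFun (D n).obs (P n))
    (hinfo : ∃ A : Matrix (Fin m) (Fin m) ℝ, A.PosDef ∧
      ∀ᶠ n in atTop, ((D n).infoMatrix (P n) lam τ β₀ - A).PosSemidef) :
    Tendsto (fun n => P n {ω | ∃! β, (D n).score τ β ω = 0}) atTop (𝓝 1) ∧
    ∀ βhat : ∀ n, Ω n → EuclideanSpace ℝ (Fin m),
      (∀ n, ∀ᵐ ω ∂(P n), (∃! β, (D n).score τ β ω = 0) → (D n).score τ (βhat n ω) ω = 0) →
      ∀ ε : ℝ, 0 < ε → Tendsto (fun n => P n {ω | ε ≤ ‖βhat n ω - β₀‖}) atTop (𝓝 0) := by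
  suffices hbad : ∀ ε : ℝ, 0 < ε → Tendsto (fun n => P n {ω | ¬ ExistsUniqueNear β₀ ε fun β =>
      (D n).score τ β ω = 0}) atTop (𝓝 0) from
    ⟨tendsto_measure_existsUnique (hbad 1 one_pos),
      fun βhat hβhat ε hε => tendsto_measure_le_norm_sub (hbad ε hε) hβhat⟩
  intro ε hε
  obtain ⟨A, hA, hAinfo⟩ := hinfo
  obtain ⟨α, hα, hcoercive⟩ := exists_pos_mul_norm_sq_le_of_posDef hA
  obtain ⟨η, hη, hηlt⟩ := exists_between
    (lt_min (half_pos hα) (mul_pos (Real.exp_pos (-(2 * (ε * K)))) (mul_pos (half_pos hα) hε)))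
  obtain ⟨hη_info, hη_score⟩ := lt_min_iff.1 hηlt
  have hlim := ENNReal.tendsto_ofReal (tendsto_sqrt_add_nat_mul_div hr ((m * K + m * (m * K ^ 2)) *
    (2 + 12 * (Real.exp (‖β₀‖ * K) * (hazardMeasure lam τ).real Set.univ))) η)
  rw [ENNReal.ofReal_zero] at hlim
  refine tendsto_of_tendsto_of_tendsto_of_le_of_le' tendsto_const_nhds hlim
    (.of_forall fun n => zero_le) ?_
  filter_upwards [hAinfo, eventually_ne_atTop 0, hr.eventually_le_const one_pos] with n hAn hn hrn
  refine (SurvivalSample.measure_not_existsUniqueNear_score_eq_zero_le hn (hcox n).nonneg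
    (hcox n).norm_le hε hα (fun h => mul_norm_sq_le_of_posSemidef_sub hAn (hcoercive h)) hη
    hη_info.le hη_score.le).trans (ENNReal.ofReal_le_ofReal ?_)
  rw [mul_assoc]
  exact div_le_div_of_nonneg_right
    ((hcox n).integral_estimationError_le hrn hτ hlam hΛ (hind n)) (by positivity)

theorem theorem2 {m : ℕ} (j : Fin m) (β₀ : EuclideanSpace ℝ (Fin m)) (c : ℝ)
    (lam : ℝ → ℝ) (τ : ℝ)
    -- for each `n`, a sample of `n` units on its own probability space
    (Ω : ℕ → Type*) [∀ n, MeasurableSpace (Ω n)]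
    (P : ∀ n, Measure (Ω n)) [∀ n, IsProbabilityMeasure (P n)]
    (D : ∀ n, SurvivalSample m n (Ω n))
    (hlam : ∀ t, 0 ≤ lam t)
    -- the alternative model with true value `β₀` and `γ_j = c / √n`
    (hhazard : ∀ n, (D n).HasHazard (P n) τ (hazardRate lam j β₀ (c / √(n : ℝ))))
    (hintensity : ∀ n, (D n).HasIntensity (P n) τ (hazardRate lam j β₀ (c / √(n : ℝ))))
    -- a) i.i.d. observations
    (hiid : ∀ n, (D n).IsIID (P n))
    -- b) `sup {t : Y(t) > 0} → τ > 0` in probability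
    (hτ : 0 < τ)
    (hlast : ∀ ε : ℝ, 0 < ε → Tendsto
      (fun n => P n {ω | ENNReal.ofReal ε ≤ edist ((D n).lastAtRisk ω) (ENNReal.ofReal τ)})
      atTop (𝓝 0))
    -- c) bounded covariates
    (hz : ∃ K : ℝ, 0 < K ∧ ∀ n i, ∀ᵐ ω ∂(P n), ‖(D n).z i ω‖ ≤ K)
    -- d) `Λ(τ) < ∞`
    (hΛ : IntervalIntegrable lam volume 0 τ)
    -- e) the matrices `Σ(β₀)` are positive definite, without degenerating as `n → ∞`
    (hinfo : ∃ A : Matrix (Fin m) (Fin m) ℝ, A.PosDef ∧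
      ∀ᶠ n in atTop, ((D n).infoMatrix (P n) lam τ β₀ - A).PosSemidef) :
    Tendsto (fun n => P n {ω | ∃! β, (D n).score τ β ω = 0}) atTop (𝓝 1) ∧
    ∀ βhat : ∀ n, Ω n → EuclideanSpace ℝ (Fin m),
      (∀ n, ∀ᵐ ω ∂(P n), (∃! β, (D n).score τ β ω = 0) → (D n).score τ (βhat n ω) ω = 0) →
      ∀ ε : ℝ, 0 < ε → Tendsto (fun n => P n {ω | ε ≤ ‖βhat n ω - β₀‖}) atTop (𝓝 0) := by
  obtain ⟨K, hK, hz⟩ := hz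
  exact theorem2_general β₀ lam τ K (fun n => Real.exp (|c / √(n : ℝ)| * K) - 1) _ Ω P D hlam hτ hΛ
    (fun n => SurvivalSample.isNearCox_of_hazardRate hτ.le hlam hΛ j β₀ _ hK.le (hz n) (hhazard n)
      (hintensity n))
    (tendsto_exp_abs_div_sqrt_mul_sub_one c K) (fun n => (hiid n).1) hinfo
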